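/- **Setting.** Let $V$ be a finite dimensional vector space over a field $\Bbbk$, let $0\ne q\in\Bbbk$, and let $R:V\otimes V\to V\otimes V$ be a Hecke symmetry with parameter $q$, i.e. a linear operator satisfying the braid equation $(R\otimes\mathrm{Id})(\mathrm{Id}\otimes R)(R\otimes\mathrm{Id})=(\mathrm{Id}\otimes R)(R\otimes\mathrm{Id})(\mathrm{Id}\otimes R)$ on $V^{\otimes 3}$ and the relation $(R-q\,\mathrm{Id})(R+\mathrm{Id})=0$ (no further restriction on $q$). Let $\mathcal H_n$ be the Hecke algebra of type $A_{n-1}$ with parameter $q$: it has generators $T_1,\dots,T_{n-1}$ and relations $T_iT_{i+1}T_i=T_{i+1}T_iT_{i+1}$, $T_iT_j=T_jT_i$ for $|i-j|>1$, $(T_i-q)(T_i+1)=0$. It acts on $V^{\otimes n}$ by $T_i\mapsto \mathrm{Id}^{\otimes(i-1)}\otimes R\otimes\mathrm{Id}^{\otimes(n-i-1)}$. For $\sigma\in\mathfrak S_n$ let $\ell(\sigma)$ be its number of inversions and let $T_\sigma=T_{i_1}\cdots T_{i_r}$, where $\sigma=\tau_{i_1}\cdots\tau_{i_r}$ is any reduced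 expression in the basic transpositions $\tau_i=(i,i+1)$. Put $$y_n=\sum_{\sigma\in\mathfrak S_n}(-1)^{\ell(\sigma)}q^{n(n-1)/2-\ell(\sigma)}\,T_\sigma,\qquad y_{k+l/k,l}=\sum_{d}(-1)^{\ell(d)}q^{kl-\ell(d)}\,T_d ,$$ the second sum being over all $d\in\mathfrak S_{k+l}$ that are increasing on $\{1,\dots,k\}$ and on $\{k+1,\dots,k+l\}$. Let $\Upsilon^{(n)}=\bigcap_{i=1}^{n-1}(T_i-q)V^{\otimes n}\subseteq V^{\otimes n}$ (so $\Upsilon^{(0)}=\Bbbk$, $\Upsilon^{(1)}=V$), and let $\Upsilon(V,R)=\bigoplus_{n\ge0}\Upsilon^{(n)}$ be the graded associative unital algebra with multiplication $a\star b=y_{k+l/k,l}(a\otimes b)$ for $a\in\Upsilon^{(k)}$, $b\in\Upsilon^{(l)}$. Let $\Lambda(V,R)$ be the factor algebra of the tensor algebra $\mathbb T(V)$ by the two-sided ideal generated by $\mathrm{Ker}(R-q\,\mathrm{Id})\subseteq V^{\otimes2}$, graded by the images $\Lambda_m(V,R)$ of the $V^{\otimes m}$. **Proposition 2.6.** Let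 $n\ge 0$ and suppose that $\dim\Upsilon^{(n)}=1$ and $\Upsilon^{(n+1)}=0$. Then the following conditions are equivalent: (i) the action of $y_n$ on $V^{\otimes n}$ is nonzero; (ii) the algebra $\Upsilon(V,R)$ is generated by its component $\Upsilon^{(1)}=V$; (iii) the algebra $\Upsilon(V,R)$ is isomorphic to a factor algebra of $\Lambda(V,R)$ by a two-sided ideal; (iii′) the algebra $\Upsilon(V,R)$ is isomorphic to a factor algebra of $\Lambda(V,R)$ as a graded algebra, that is, by an algebra isomorphism that maps the image of each $\Lambda_m(V,R)$ into $\Upsilon^{(m)}$. -/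

import Mathlib

open scoped TensorProduct DirectSum

namespace HeckeSym

noncomputable section

/-! ### Permutations -/

/-- The basic transposition exchanging `i` and `i + 1` (positions are numbered from `0`). -/
def tau {n : ℕ} (i : Fin (n - 1)) : Equiv.Perm (Fin n) :=
  Equiv.swap ⟨i, by omega⟩ ⟨i + 1, by omega⟩

/-- The inversions of a permutation. -/
def invSet {n : ℕ} (σ : Equiv.Perm (Fin n)) : Finset (Fin n × Fin n) :=
  {p | p.1 < p.2 ∧ σ p.2 < σ p.1}

/-- The length of a permutation: the number of its inversions. -/
def len {n : ℕ} (σ : Equiv.Perm (Fin n)) : ℕ := (invSet σ).card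

/-- `w` is a reduced expression of `σ` as a product of basic transpositions. -/
def IsReducedWord {n : ℕ} (w : List (Fin (n - 1))) (σ : Equiv.Perm (Fin n)) : Prop :=
  (w.map tau).prod = σ ∧ w.length = len σ

theorem mem_invSet {n : ℕ} (σ : Equiv.Perm (Fin n)) (p : Fin n × Fin n) :
    p ∈ invSet σ ↔ p.1 < p.2 ∧ σ p.2 < σ p.1 := by simp [invSet]

theorem tau_mul_self {n : ℕ} (i : Fin (n - 1)) : tau i * tau i = 1 := by simp [tau]

theorem tau_inv {n : ℕ} (i : Fin (n - 1)) : (tau i)⁻¹ = tau i := by simp [tau]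

theorem tau_val {n : ℕ} (i : Fin (n - 1)) (x : Fin n) :
    ((tau i x : Fin n) : ℕ) = if (x : ℕ) = i then (i : ℕ) + 1 else if (x : ℕ) = i + 1 then (i : ℕ) else x := by
  unfold tau
  rw [Equiv.swap_apply_def]
  simp only [Fin.ext_iff]
  split_ifs <;> rfl

theorem len_tau_mul {n : ℕ} (i : Fin (n - 1)) (σ : Equiv.Perm (Fin n))
    (h : σ⁻¹ ⟨i, by omega⟩ < σ⁻¹ ⟨i + 1, by omega⟩) : len (tau i * σ) = len σ + 1 := by
  have key : invSet (tau i * σ) =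
      insert (σ⁻¹ ⟨i, by omega⟩, σ⁻¹ ⟨i + 1, by omega⟩) (invSet σ) := by
    ext ⟨a, b⟩
    rw [Finset.mem_insert, mem_invSet, mem_invSet]
    simp only [Equiv.Perm.mul_apply, Prod.mk.injEq, Fin.lt_def, tau_val,
      Equiv.Perm.eq_inv_iff_eq, Fin.ext_iff]
    have hab : (σ a : ℕ) = σ b → (a : ℕ) = b := fun e => by
      rw [σ.injective (Fin.ext e)]
    by_cases ha : (σ a : ℕ) = i
    · by_cases hb : (σ b : ℕ) = i + 1
      · have e1 : σ⁻¹ ⟨i, by omega⟩ = a := by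
          rw [Equiv.Perm.inv_eq_iff_eq]; exact Fin.ext ha.symm
        have e2 : σ⁻¹ ⟨i + 1, by omega⟩ = b := by
          rw [Equiv.Perm.inv_eq_iff_eq]; exact Fin.ext hb.symm
        rw [e1, e2, Fin.lt_def] at h
        simp only [ha, hb]; simp; omega
      · split_ifs <;> omega
    · by_cases hb : (σ b : ℕ) = i ∧ (σ a : ℕ) = i + 1
      · have e1 : σ⁻¹ ⟨i, by omega⟩ = b := by
          rw [Equiv.Perm.inv_eq_iff_eq]; exact Fin.ext hb.1.symm
        have e2 : σ⁻¹ ⟨i + 1, by omega⟩ = a := by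
          rw [Equiv.Perm.inv_eq_iff_eq]; exact Fin.ext hb.2.symm
        rw [e1, e2, Fin.lt_def] at h
        simp only [hb.1, hb.2]; simp; omega
      · split_ifs <;> omega
  rw [len, key, Finset.card_insert_of_notMem, len]
  rw [mem_invSet]
  rintro ⟨-, h2⟩
  simp only [Equiv.Perm.inv_def, Equiv.apply_symm_apply, Fin.lt_def] at h2
  omega

theorem len_tau_mul' {n : ℕ} (i : Fin (n - 1)) (σ : Equiv.Perm (Fin n))
    (h : σ⁻¹ ⟨i + 1, by omega⟩ < σ⁻¹ ⟨i, by omega⟩) : len (tau i * σ) + 1 = len σ := by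
  have := len_tau_mul i (tau i * σ) (by simpa [mul_inv_rev, tau] using h)
  rw [← mul_assoc, tau_mul_self, one_mul] at this
  exact this.symm

theorem lt_of_len_tau_mul {n : ℕ} (i : Fin (n - 1)) (σ : Equiv.Perm (Fin n))
    (h : len (tau i * σ) + 1 = len σ) : σ⁻¹ ⟨i + 1, by omega⟩ < σ⁻¹ ⟨i, by omega⟩ := by
  rcases lt_trichotomy (σ⁻¹ ⟨i + 1, by omega⟩) (σ⁻¹ ⟨i, by omega⟩) with h1 | h1 | h1
  · exact h1
  · simp [Fin.ext_iff] at h1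
  · have := len_tau_mul i σ h1
    omega

theorem len_one {n : ℕ} : len (1 : Equiv.Perm (Fin n)) = 0 := by
  rw [len, Finset.card_eq_zero, Finset.eq_empty_iff_forall_notMem]
  intro p hp
  rw [mem_invSet] at hp
  exact lt_asymm hp.1 hp.2

theorem eq_one_of_adjacent {n : ℕ} (σ : Equiv.Perm (Fin n))
    (h : ∀ i : Fin (n - 1), σ ⟨i, by omega⟩ < σ ⟨i + 1, by omega⟩) : σ = 1 := by
  have hm : StrictMono σ := by
    cases n with
    | zero => intro a; exact a.elim0
    | succ m =>
      rw [Fin.strictMono_iff_lt_succ]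
      intro i
      exact h ⟨i, by simp⟩
  have h2 : (hm.orderIsoOfSurjective σ σ.surjective) = OrderIso.refl _ := Subsingleton.elim _ _
  ext x
  have := congrArg (fun f => f x) h2
  simpa using congrArg Fin.val this

theorem len_inv {n : ℕ} (σ : Equiv.Perm (Fin n)) : len σ⁻¹ = len σ := by
  unfold len
  refine Finset.card_bij' (fun p _ => (σ⁻¹ p.2, σ⁻¹ p.1)) (fun p _ => (σ p.2, σ p.1)) ?_ ?_ ?_ ?_ <;>
  · intro p hp
    simp_all [mem_invSet]

theorem exists_reducedWord {n : ℕ} (σ : Equiv.Perm (Fin n)) : ∃ w, IsReducedWord w σ := by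
  induction hm : len σ generalizing σ with
  | zero =>
    have h1 : σ⁻¹ = 1 := by
      apply eq_one_of_adjacent
      intro i
      rcases lt_trichotomy (σ⁻¹ ⟨i + 1, by omega⟩) (σ⁻¹ ⟨i, by omega⟩) with h1 | h1 | h1
      · have := len_tau_mul' i σ h1
        omega
      · simp [Fin.ext_iff] at h1
      · exact h1
    rw [inv_eq_one] at h1
    exact ⟨[], by simp [h1], by simp [hm]⟩
  | succ m ih =>
    have : ∃ i : Fin (n - 1), σ⁻¹ ⟨i + 1, by omega⟩ < σ⁻¹ ⟨i, by omega⟩ := by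
      by_contra! hc
      have h1 : σ⁻¹ = 1 := by
        apply eq_one_of_adjacent
        intro i
        refine lt_of_le_of_ne (hc i) ?_
        simp [Fin.ext_iff]
      rw [inv_eq_one] at h1
      rw [h1, len_one] at hm
      omega
    obtain ⟨i, hi⟩ := this
    have h2 := len_tau_mul' i σ hi
    obtain ⟨w, hw1, hw2⟩ := ih (tau i * σ) (by omega)
    refine ⟨i :: w, ?_, ?_⟩
    · rw [List.map_cons, List.prod_cons, hw1, ← mul_assoc, tau_mul_self, one_mul]
    · rw [List.length_cons, hw2, h2]

theorem len_mul_le_word {n : ℕ} (w : List (Fin (n - 1))) : len (w.map tau).prod ≤ w.length := by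
  induction w with
  | nil => simp [len_one]
  | cons i w ih =>
    rw [List.map_cons, List.prod_cons, List.length_cons]
    rcases lt_trichotomy ((w.map tau).prod⁻¹ ⟨i + 1, by omega⟩)
      ((w.map tau).prod⁻¹ ⟨i, by omega⟩) with h1 | h1 | h1
    · have := len_tau_mul' i _ h1
      omega
    · simp [Fin.ext_iff] at h1
    · have := len_tau_mul i _ h1
      omega

theorem IsReducedWord.tail {n : ℕ} {i : Fin (n - 1)} {w : List (Fin (n - 1))}
    {σ : Equiv.Perm (Fin n)} (h : IsReducedWord (i :: w) σ) :
    IsReducedWord w (tau i * σ) ∧ len (tau i * σ) + 1 = len σ := by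
  obtain ⟨h1, h2⟩ := h
  rw [List.map_cons, List.prod_cons] at h1
  have h3 : (w.map tau).prod = tau i * σ := by
    rw [← h1, ← mul_assoc, tau_mul_self, one_mul]
  have h4 := len_mul_le_word w
  rw [h3] at h4
  rw [List.length_cons] at h2
  have h5 : len σ ≤ len (tau i * σ) + 1 := by
    rcases lt_trichotomy (σ⁻¹ ⟨i + 1, by omega⟩) (σ⁻¹ ⟨i, by omega⟩) with h1 | h1 | h1
    · have := len_tau_mul' i σ h1
      omega
    · simp [Fin.ext_iff] at h1
    · have := len_tau_mul i σ h1
      omega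
  exact ⟨⟨h3, by omega⟩, by omega⟩

theorem IsReducedWord.cons {n : ℕ} {i : Fin (n - 1)} {w : List (Fin (n - 1))}
    {σ : Equiv.Perm (Fin n)} (h : IsReducedWord w (tau i * σ))
    (h2 : len (tau i * σ) + 1 = len σ) : IsReducedWord (i :: w) σ := by
  refine ⟨?_, ?_⟩
  · rw [List.map_cons, List.prod_cons, h.1, ← mul_assoc, tau_mul_self, one_mul]
  · rw [List.length_cons, h.2, h2]

/-! ### The Hecke algebra of type `A` -/

section

variable {𝕜 : Type*} [Field 𝕜]

/-- The defining relations of the Hecke algebra of type `A_{n-1}` with parameter `q`. -/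
inductive HeckeRel (q : 𝕜) (n : ℕ) :
    FreeAlgebra 𝕜 (Fin (n - 1)) → FreeAlgebra 𝕜 (Fin (n - 1)) → Prop
  | braid (i j : Fin (n - 1)) (h : (i : ℕ) + 1 = j) : HeckeRel q n
      (FreeAlgebra.ι 𝕜 i * FreeAlgebra.ι 𝕜 j * FreeAlgebra.ι 𝕜 i)
      (FreeAlgebra.ι 𝕜 j * FreeAlgebra.ι 𝕜 i * FreeAlgebra.ι 𝕜 j)
  | comm (i j : Fin (n - 1)) (h : (i : ℕ) + 1 < j) : HeckeRel q n
      (FreeAlgebra.ι 𝕜 i * FreeAlgebra.ι 𝕜 j) (FreeAlgebra.ι 𝕜 j * FreeAlgebra.ι 𝕜 i)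
  | quad (i : Fin (n - 1)) : HeckeRel q n
      ((FreeAlgebra.ι 𝕜 i - algebraMap 𝕜 _ q) * (FreeAlgebra.ι 𝕜 i + 1)) 0

/-- The Hecke algebra of type `A_{n-1}` with parameter `q`, by generators and relations. -/
abbrev HeckeAlgebra (q : 𝕜) (n : ℕ) := RingQuot (HeckeRel q n)

namespace HeckeAlgebra

/-- The generators of the Hecke algebra. -/
def gen (q : 𝕜) {n : ℕ} (i : Fin (n - 1)) : HeckeAlgebra q n :=
  RingQuot.mkAlgHom 𝕜 (HeckeRel q n) (FreeAlgebra.ι 𝕜 i)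

variable (q : 𝕜) {n : ℕ}

theorem gen_braid (i j : Fin (n - 1)) (h : (i : ℕ) + 1 = j) :
    gen q i * gen q j * gen q i = gen q j * gen q i * gen q j := by
  simpa [gen] using RingQuot.mkAlgHom_rel 𝕜 (HeckeRel.braid (q := q) i j h)

theorem gen_comm (i j : Fin (n - 1)) (h : (i : ℕ) + 1 < j) :
    gen q i * gen q j = gen q j * gen q i := by
  simpa [gen] using RingQuot.mkAlgHom_rel 𝕜 (HeckeRel.comm (q := q) i j h)

theorem gen_quad (i : Fin (n - 1)) :
    (gen q i - algebraMap 𝕜 _ q) * (gen q i + 1) = 0 := by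
  simpa [gen, -RingQuot.mkAlgHom_coe, -algebraMap_apply] using RingQuot.mkAlgHom_rel 𝕜 (HeckeRel.quad (q := q) i)

/-- The universal property of the Hecke algebra. -/
def lift {A : Type*} [Ring A] [Algebra 𝕜 A] (t : Fin (n - 1) → A)
    (hb : ∀ i j : Fin (n - 1), (i : ℕ) + 1 = j → t i * t j * t i = t j * t i * t j)
    (hc : ∀ i j : Fin (n - 1), (i : ℕ) + 1 < j → t i * t j = t j * t i)
    (hq : ∀ i, (t i - algebraMap 𝕜 A q) * (t i + 1) = 0) : HeckeAlgebra q n →ₐ[𝕜] A :=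
  RingQuot.liftAlgHom 𝕜 ⟨FreeAlgebra.lift 𝕜 t, by
    intro x y h
    induction h with
    | braid i j h => simpa using hb i j h
    | comm i j h => simpa using hc i j h
    | quad i => simpa using hq i⟩

theorem lift_gen {A : Type*} [Ring A] [Algebra 𝕜 A] (t : Fin (n - 1) → A) (hb) (hc) (hq)
    (i : Fin (n - 1)) : lift q t hb hc hq (gen q i) = t i := by
  simp [lift, gen]

theorem hom_ext {A : Type*} [Ring A] [Algebra 𝕜 A] {f g : HeckeAlgebra q n →ₐ[𝕜] A}
    (h : ∀ i, f (gen q i) = g (gen q i)) : f = g := by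
  apply RingQuot.ringQuot_ext'
  apply FreeAlgebra.hom_ext
  funext i
  exact h i

/-- The standard basis element `T_σ`: the product of generators along a reduced expression
of `σ`. -/
def T (σ : Equiv.Perm (Fin n)) : HeckeAlgebra q n :=
  ((Classical.choose (exists_reducedWord σ)).map (gen q)).prod

theorem word_eq {w w' : List (Fin (n - 1))} {σ : Equiv.Perm (Fin n)} (hw : IsReducedWord w σ)
    (hw' : IsReducedWord w' σ) : (w.map (gen q)).prod = (w'.map (gen q)).prod := by
  induction hm : len σ using Nat.strong_induction_on generalizing σ w w' with
  | _ m ih =>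
  subst hm
  -- the case of distinct first letters `i < j`
  have main : ∀ (i j : Fin (n - 1)) (u u' : List (Fin (n - 1))), (i : ℕ) < j →
      IsReducedWord (i :: u) σ → IsReducedWord (j :: u') σ →
      ((i :: u).map (gen q)).prod = ((j :: u').map (gen q)).prod := by
    intro i j u u' hij hi hj
    obtain ⟨hi1, hi2⟩ := hi.tail
    obtain ⟨hj1, hj2⟩ := hj.tail
    have di := lt_of_len_tau_mul i σ hi2
    have dj := lt_of_len_tau_mul j σ hj2
    rcases Nat.lt_or_ge ((i : ℕ) + 1) j with h | h
    · have c : tau i * tau j = tau j * tau i := by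
        ext x
        simp only [Equiv.Perm.mul_apply, tau_val]
        split_ifs <;> omega
      have l1 : len (tau j * (tau i * σ)) + 1 = len (tau i * σ) := by
        apply len_tau_mul'
        rw [mul_inv_rev, tau_inv, Equiv.Perm.mul_apply, Equiv.Perm.mul_apply]
        have e1 : tau i ⟨j + 1, by omega⟩ = ⟨j + 1, by omega⟩ := by
          ext; rw [tau_val]; simp only []; split_ifs <;> omega
        have e2 : tau i ⟨j, by omega⟩ = ⟨j, by omega⟩ := by
          ext; rw [tau_val]; simp only []; split_ifs <;> omega
        rwa [e1, e2]
      have l2 : len (tau i * (tau j * σ)) + 1 = len (tau j * σ) := by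
        rw [← mul_assoc, c, mul_assoc]; omega
      obtain ⟨x, hx⟩ := exists_reducedWord (tau j * (tau i * σ))
      have a1 := ih _ (by omega) hi1 (hx.cons l1) rfl
      have hx' : IsReducedWord x (tau i * (tau j * σ)) := by
        rw [← mul_assoc, c, mul_assoc]; exact hx
      have a2 := ih _ (by omega) hj1 (hx'.cons l2) rfl
      simp only [List.map_cons, List.prod_cons] at a1 a2 ⊢
      rw [a1, a2, ← mul_assoc, gen_comm q i j h, mul_assoc]
    · have h : (i : ℕ) + 1 = j := by omega
      have ej : (⟨j, by omega⟩ : Fin n) = ⟨i + 1, by omega⟩ := by simp [h]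
      have c : tau i * (tau j * tau i) = tau j * (tau i * tau j) := by
        rw [← mul_assoc, ← mul_assoc]
        simp only [tau, ej]
        have gen3 : ∀ a b c : Fin n, a ≠ b → b ≠ c → a ≠ c →
            Equiv.swap a b * Equiv.swap b c * Equiv.swap a b =
              Equiv.swap b c * Equiv.swap a b * Equiv.swap b c := by
          intro a b c hab hbc hac
          rw [Equiv.swap_mul_swap_mul_swap hab hac, Equiv.swap_comm a b, Equiv.swap_comm b c,
            Equiv.swap_mul_swap_mul_swap hbc.symm hac.symm, Equiv.swap_comm]
        apply gen3
        all_goals simp [Fin.ext_iff]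
        all_goals omega
      rw [ej] at dj
      have e1 : tau i ⟨j + 1, by omega⟩ = ⟨j + 1, by omega⟩ := by
        ext; rw [tau_val]; simp only []; split_ifs <;> omega
      have e2 : tau i ⟨j, by omega⟩ = ⟨i, by omega⟩ := by
        ext; rw [tau_val]; simp only []; split_ifs <;> omega
      have e3 : tau j ⟨i, by omega⟩ = ⟨i, by omega⟩ := by
        ext; rw [tau_val]; simp only []; split_ifs <;> omega
      have e4 : tau j ⟨i + 1, by omega⟩ = ⟨j + 1, by omega⟩ := by
        ext; rw [tau_val]; simp only []; split_ifs <;> omega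
      have e5 : tau i ⟨i, by omega⟩ = ⟨i + 1, by omega⟩ := by
        ext; rw [tau_val]; simp only []; split_ifs <;> omega
      have e6 : tau j ⟨j + 1, by omega⟩ = ⟨i + 1, by omega⟩ := by
        ext; rw [tau_val]; simp only []; split_ifs <;> omega
      have l1 : len (tau j * (tau i * σ)) + 1 = len (tau i * σ) := by
        apply len_tau_mul'
        rw [mul_inv_rev, tau_inv, Equiv.Perm.mul_apply, Equiv.Perm.mul_apply, e1, e2]
        exact dj.trans di
      have l2 : len (tau i * (tau j * (tau i * σ))) + 1 = len (tau j * (tau i * σ)) := by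
        apply len_tau_mul'
        simp only [mul_inv_rev, tau_inv, Equiv.Perm.mul_apply, e3, e4, e5, e1]
        exact dj
      have l3 : len (tau i * (tau j * σ)) + 1 = len (tau j * σ) := by
        apply len_tau_mul'
        simp only [mul_inv_rev, tau_inv, Equiv.Perm.mul_apply, e3, e4]
        exact dj.trans di
      have cc : tau i * (tau j * (tau i * σ)) = tau j * (tau i * (tau j * σ)) := by
        simpa only [mul_assoc] using congrArg (· * σ) c
      have l4 : len (tau j * (tau i * (tau j * σ))) + 1 = len (tau i * (tau j * σ)) := by
        rw [← cc]; omega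
      obtain ⟨x, hx⟩ := exists_reducedWord (tau i * (tau j * (tau i * σ)))
      have a1 := ih _ (by omega) hi1 ((hx.cons l2).cons l1) rfl
      rw [cc] at hx
      have a2 := ih _ (by omega) hj1 ((hx.cons l4).cons l3) rfl
      simp only [List.map_cons, List.prod_cons] at a1 a2 ⊢
      rw [a1, a2]
      have := gen_braid q i j h
      simp only [← mul_assoc]
      rw [this]
  cases w with
  | nil =>
    have h0 := hw.2
    have h1 := hw'.2
    rw [← h0] at h1
    simp at h1
    simp [h1]
  | cons i u =>
    cases w' with
    | nil =>
      have h0 := hw.2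
      have h1 := hw'.2
      rw [← h0] at h1
      simp at h1
    | cons j u' =>
      rcases lt_trichotomy (i : ℕ) j with h | h | h
      · exact main i j u u' h hw hw'
      · have h : i = j := Fin.ext h
        subst h
        rw [List.map_cons, List.map_cons, List.prod_cons, List.prod_cons]
        rw [ih _ (by have := hw.tail.2; omega) hw.tail.1 hw'.tail.1 rfl]
      · exact (main j i u' u h hw' hw).symm

theorem T_eq {w : List (Fin (n - 1))} {σ : Equiv.Perm (Fin n)} (hw : IsReducedWord w σ) :
    T q σ = (w.map (gen q)).prod :=
  word_eq q (Classical.choose_spec (exists_reducedWord σ)) hw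

theorem T_one : T q (1 : Equiv.Perm (Fin n)) = 1 := by
  rw [T_eq q (w := []) ⟨by simp, by simp [len_one]⟩]; simp

theorem T_mul {π σ : Equiv.Perm (Fin n)} (h : len (π * σ) = len π + len σ) :
    T q (π * σ) = T q π * T q σ := by
  obtain ⟨w, hw⟩ := exists_reducedWord π
  obtain ⟨v, hv⟩ := exists_reducedWord σ
  rw [T_eq q hw, T_eq q hv, T_eq q (w := w ++ v) ⟨by simp [hw.1, hv.1], by simp [hw.2, hv.2, h]⟩]
  simp

end HeckeAlgebra
end

/-! ### Extending permutations by a fixed last point -/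

/-- The embedding of the permutations of `Fin n` as permutations of `Fin (n + 1)` fixing the last
point. -/
def extLast {n : ℕ} (σ : Equiv.Perm (Fin n)) : Equiv.Perm (Fin (n + 1)) where
  toFun := Fin.lastCases (Fin.last n) (fun i => (σ i).castSucc)
  invFun := Fin.lastCases (Fin.last n) (fun i => (σ⁻¹ i).castSucc)
  left_inv x := by induction x using Fin.lastCases <;> simp
  right_inv x := by induction x using Fin.lastCases <;> simp

@[simp]
theorem extLast_last {n : ℕ} (σ : Equiv.Perm (Fin n)) :
    extLast σ (Fin.last n) = Fin.last n := by simp [extLast]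

@[simp]
theorem extLast_castSucc {n : ℕ} (σ : Equiv.Perm (Fin n)) (i : Fin n) :
    extLast σ i.castSucc = (σ i).castSucc := by simp [extLast]

theorem extLast_one {n : ℕ} : extLast (1 : Equiv.Perm (Fin n)) = 1 := by
  ext x
  induction x using Fin.lastCases <;> simp

theorem extLast_mul {n : ℕ} (σ π : Equiv.Perm (Fin n)) :
    extLast (σ * π) = extLast σ * extLast π := by
  ext x
  induction x using Fin.lastCases <;> simp

theorem extLast_injective {n : ℕ} : Function.Injective (extLast (n := n)) := by
  intro σ π h
  ext x
  have := congrArg (fun f => f x.castSucc) h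
  simpa using congrArg Fin.val this

theorem exists_extLast {n : ℕ} (d : Equiv.Perm (Fin (n + 1))) (h : d (Fin.last n) = Fin.last n) :
    ∃ σ, extLast σ = d := by
  have h' : d⁻¹ (Fin.last n) = Fin.last n := by rw [Equiv.Perm.inv_eq_iff_eq, h]
  have a : ∀ (e : Equiv.Perm (Fin (n + 1))), e (Fin.last n) = Fin.last n →
      ∀ i : Fin n, e i.castSucc ≠ Fin.last n := by
    intro e he i hi
    rw [← he] at hi
    exact (Fin.castSucc_ne_last i) (e.injective hi)
  refine ⟨⟨fun i => (d i.castSucc).castPred (a d h i), fun i => (d⁻¹ i.castSucc).castPred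
    (a d⁻¹ h' i), fun i => ?_, fun i => ?_⟩, ?_⟩
  · simp
  · simp
  · ext x
    induction x using Fin.lastCases with
    | last => simp [h]
    | cast i => simp

theorem len_extLast {n : ℕ} (σ : Equiv.Perm (Fin n)) : len (extLast σ) = len σ := by
  have : invSet (extLast σ) = (invSet σ).map
      (Function.Embedding.prodMap Fin.castSuccEmb Fin.castSuccEmb) := by
    ext ⟨a, b⟩
    rw [mem_invSet, Finset.mem_map]
    simp only [Prod.exists, mem_invSet]
    induction a using Fin.lastCases with
    | last => simp [Fin.not_lt.2 (Fin.le_last _)]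
    | cast a =>
      induction b using Fin.lastCases with
      | last => simp [Fin.not_lt.2 (Fin.le_last _)]
      | cast b => simp
  rw [len, this, Finset.card_map, len]

theorem extLast_tau {n : ℕ} (i : Fin (n - 1)) :
    extLast (tau i) = tau (n := n + 1) ⟨i, by omega⟩ := by
  ext x
  rw [tau_val]
  induction x using Fin.lastCases with
  | last => simp; split_ifs <;> omega
  | cast x => simp [tau_val]

theorem isReducedWord_extLast {n : ℕ} {w : List (Fin (n - 1))} {σ : Equiv.Perm (Fin n)}
    (h : IsReducedWord w σ) :
    IsReducedWord (n := n + 1) (w.map fun i : Fin (n - 1) => ⟨i, by omega⟩) (extLast σ) := by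
  refine ⟨?_, by rw [List.length_map, len_extLast, h.2]⟩
  rw [← h.1]
  clear h
  induction w with
  | nil => simp [extLast_one]
  | cons i w ih =>
    simp only [List.map_cons, List.prod_cons, extLast_mul, extLast_tau, ih]

theorem len_mul_tau {n : ℕ} (i : Fin (n - 1)) (σ : Equiv.Perm (Fin n))
    (h : σ ⟨i, by omega⟩ < σ ⟨i + 1, by omega⟩) : len (σ * tau i) = len σ + 1 := by
  rw [← len_inv, mul_inv_rev, tau_inv, ← len_inv σ]
  exact len_tau_mul i σ⁻¹ (by simpa using h)

theorem len_tau {n : ℕ} (i : Fin (n - 1)) : len (tau i) = 1 := by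
  have := len_mul_tau i 1 (by simp [Fin.lt_def])
  simpa [len_one] using this

/-! ### Shuffles -/

/-- The distinguished representatives of the left cosets of the Young subgroup of permutations
that leave `{0, …, k - 1}` and `{k, …, n - 1}` stable: the permutations that are increasing on
both of these subsets. -/
def shuffles (n k : ℕ) : Finset (Equiv.Perm (Fin n)) :=
  {d | ∀ i : Fin (n - 1), (i : ℕ) + 1 ≠ k → d ⟨i, by omega⟩ < d ⟨i + 1, by omega⟩}

theorem mem_shuffles {n k : ℕ} {d : Equiv.Perm (Fin n)} : d ∈ shuffles n k ↔
    ∀ i : ℕ, ∀ h : i + 1 < n, i + 1 ≠ k → d ⟨i, by omega⟩ < d ⟨i + 1, h⟩ := by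
  simp only [shuffles, Finset.mem_filter, Finset.mem_univ, true_and]
  exact ⟨fun H i h => H ⟨i, by omega⟩, fun H i => H i (by omega)⟩

theorem shuffles_lt {n k : ℕ} {d : Equiv.Perm (Fin n)} (hd : d ∈ shuffles n k) (a m : ℕ)
    (h : a + m + 1 < n) (h' : k ≤ a ∨ a + m + 1 < k) :
    d ⟨a, by omega⟩ < d ⟨a + m + 1, h⟩ := by
  rw [mem_shuffles] at hd
  induction m with
  | zero => exact hd a h (by omega)
  | succ m ih => exact (ih (by omega) (by omega)).trans (hd (a + m + 1) (by omega) (by omega))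

theorem len_le_of_mem_shuffles {n k : ℕ} {d : Equiv.Perm (Fin n)} (hd : d ∈ shuffles n k) :
    len d ≤ k * (n - k) := by
  have : ((Finset.range k) ×ˢ (Finset.Ico k n)).card = k * (n - k) := by simp
  rw [← this, len]
  refine Finset.card_le_card_of_injOn (fun p => ((p.1 : ℕ), (p.2 : ℕ))) ?_ ?_
  · rintro ⟨a, b⟩ h
    simp only [Finset.mem_coe, mem_invSet] at h
    simp only [Finset.coe_product, Set.mem_prod, Finset.mem_coe, Finset.mem_range, Finset.mem_Ico]
    obtain ⟨h1, h2⟩ := h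
    rw [Fin.lt_def] at h1
    by_contra hc
    obtain ⟨m, hm⟩ := Nat.exists_eq_add_of_lt h1
    have := shuffles_lt hd a m (by omega) (by omega)
    have e : (⟨a + m + 1, by omega⟩ : Fin n) = b := Fin.ext hm.symm
    rw [e] at this
    exact lt_asymm this h2
  · rintro ⟨a, b⟩ - ⟨c, d⟩ - h
    simpa [Fin.ext_iff] using h

theorem shuffles_zero (n : ℕ) : shuffles n 0 = {1} := by
  ext d
  rw [mem_shuffles, Finset.mem_singleton]
  constructor
  · intro h
    exact eq_one_of_adjacent d fun i => h i (by omega) (by omega)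
  · rintro rfl i h -
    simp [Fin.lt_def]

theorem shuffles_self (n : ℕ) : shuffles n n = {1} := by
  ext d
  rw [mem_shuffles, Finset.mem_singleton]
  constructor
  · intro h
    exact eq_one_of_adjacent d fun i => h i (by omega) (by omega)
  · rintro rfl i h -
    simp [Fin.lt_def]

/-- The cycle `(a + m) ↷ a`, that is `τ_{a+m-1} ⋯ τ_{a+1} τ_a` -/
def cyc (n : ℕ) : ℕ → ℕ → Equiv.Perm (Fin n)
  | _, 0 => 1
  | a, m + 1 => cyc n (a + 1) m * (if h : a < n - 1 then tau ⟨a, h⟩ else 1)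

section

variable {𝕜 : Type*} [Field 𝕜]

namespace HeckeAlgebra

variable (q : 𝕜) {n : ℕ}

/-- The algebra map with `T_i ↦ T_{s+i}`; the `s` step shift. -/
def shift {n N : ℕ} (s : ℕ) (h : s + n ≤ N) : HeckeAlgebra q n →ₐ[𝕜] HeckeAlgebra q N :=
  lift q (fun i => gen q ⟨s + i, by omega⟩)
    (fun i j h => gen_braid q _ _ (by simp only []; omega))
    (fun i j h => gen_comm q _ _ (by simp only []; omega))
    (fun i => gen_quad q _)

theorem shift_gen {n N : ℕ} (s : ℕ) (h : s + n ≤ N) (i : Fin (n - 1)) :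
    shift q s h (gen q i) = gen q ⟨s + i, by omega⟩ := lift_gen ..

theorem shift_shift {n N M : ℕ} (s t : ℕ) (h : s + n ≤ N) (h' : t + N ≤ M)
    (x : HeckeAlgebra q n) :
    shift q t h' (shift q s h x) = shift q (t + s) (by omega) x := by
  have : (shift q t h').comp (shift q s h) = shift q (t + s) (by omega) := by
    apply hom_ext
    intro i
    simp [shift_gen, add_assoc]
  exact congrArg (fun f => f x) this

/-- The antisymmetrizer `y_n`. -/
def antisymmetrizer (n : ℕ) : HeckeAlgebra q n :=
  ∑ σ : Equiv.Perm (Fin n), ((-1) ^ len σ * q ^ (n * (n - 1) / 2 - len σ)) • T q σ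

/-- The partial antisymmetrizer `y_{n/k,n-k}`, the sum over the distinguished left coset
representatives. -/
def shuffleAntisymmetrizer (n k : ℕ) : HeckeAlgebra q n :=
  ∑ d ∈ shuffles n k, ((-1) ^ len d * q ^ (k * (n - k) - len d)) • T q d

theorem shuffleAntisymmetrizer_zero (n : ℕ) : shuffleAntisymmetrizer q n 0 = 1 := by
  simp [shuffleAntisymmetrizer, shuffles_zero, T_one, len_one]

theorem shuffleAntisymmetrizer_self (n : ℕ) : shuffleAntisymmetrizer q n n = 1 := by
  simp [shuffleAntisymmetrizer, shuffles_self, T_one, len_one]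

/-- The generator with index `i`, as a total function on the natural numbers. -/
def g (n i : ℕ) : HeckeAlgebra q n := if h : i < n - 1 then gen q ⟨i, h⟩ else 1

theorem T_tau (i : Fin (n - 1)) : T q (tau i) = gen q i := by
  rw [T_eq q (w := [i]) ⟨by simp, by simp [len_tau]⟩]; simp

theorem T_extLast (σ : Equiv.Perm (Fin n)) :
    T q (extLast σ) = shift q 0 (by omega) (T q σ) := by
  obtain ⟨w, hw⟩ := exists_reducedWord σ
  rw [T_eq q hw, T_eq q (isReducedWord_extLast hw), map_list_prod, List.map_map, List.map_map]
  congr 1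
  refine List.map_congr_left fun i _ => ?_
  simp [shift_gen]

/-- `T_{a+m-1} ⋯ T_{a+1} T_a` -/
def descT (n : ℕ) : ℕ → ℕ → HeckeAlgebra q n
  | _, 0 => 1
  | a, m + 1 => descT n (a + 1) m * g q n a

theorem cyc_spec (σ : Equiv.Perm (Fin n)) (m a : ℕ) (ha : a + m = n) :
    (∀ x : Fin (n + 1), ((extLast σ * cyc (n + 1) a m) x : ℕ) =
      if h : (x : ℕ) < a then (σ ⟨x, by omega⟩ : ℕ) else if h' : (x : ℕ) = a then n else
        (σ ⟨x - 1, by omega⟩ : ℕ)) ∧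
    len (extLast σ * cyc (n + 1) a m) = len σ + m ∧
    T q (extLast σ * cyc (n + 1) a m) = T q (extLast σ) * descT q (n + 1) a m := by
  induction m generalizing a with
  | zero =>
    refine ⟨?_, ?_, ?_⟩
    · intro x
      induction x using Fin.lastCases with
      | last => simp [cyc]; split_ifs <;> omega
      | cast x =>
        have := x.2
        rw [dif_pos (by simp only [Fin.val_castSucc]; omega)]
        simp [cyc]
    · simp [cyc, len_extLast]
    · simp [cyc, descT]
  | succ m ih =>
    obtain ⟨h1, h2, h3⟩ := ih (a + 1) (by omega)
    have e : cyc (n + 1) a (m + 1) = cyc (n + 1) (a + 1) m * tau (n := n + 1) ⟨a, by omega⟩ := by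
      rw [cyc, dif_pos]
    have hlt : (extLast σ * cyc (n + 1) (a + 1) m) ⟨a, by omega⟩ <
        (extLast σ * cyc (n + 1) (a + 1) m) ⟨a + 1, by omega⟩ := by
      rw [Fin.lt_def, h1, h1]
      simp
    have hlen := len_mul_tau (n := n + 1) ⟨a, by omega⟩ _ hlt
    rw [e, ← mul_assoc]
    refine ⟨?_, by rw [hlen, h2, add_assoc], ?_⟩
    · intro x
      rw [Equiv.Perm.mul_apply, h1]
      have := x.2
      have ht := tau_val (n := n + 1) ⟨a, by omega⟩ x
      simp only at ht
      rcases lt_trichotomy (x : ℕ) a with hx | hx | hx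
      · rw [if_neg (by omega), if_neg (by omega)] at ht
        rw [dif_pos (by omega), dif_pos hx]
        simp only [ht]
      · rw [if_pos hx] at ht
        rw [dif_neg (by omega), dif_pos (by omega), dif_neg (by omega), dif_pos hx]
      · rw [if_neg (by omega)] at ht
        rw [dif_neg (c := (x : ℕ) < a) (by omega), dif_neg (c := (x : ℕ) = a) (by omega)]
        by_cases hx' : (x : ℕ) = a + 1
        · rw [if_pos hx'] at ht
          rw [dif_pos (by omega)]
          simp only [ht, hx', Nat.add_sub_cancel]
        · rw [if_neg hx'] at ht
          rw [dif_neg (by omega), dif_neg (by omega)]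
          simp only [ht]
    · rw [T_mul q (by rw [hlen, len_tau]), h3, T_tau, mul_assoc]
      rw [descT, g, dif_pos (by omega)]

theorem shuffleAntisymmetrizer_succ (n k : ℕ) (hk : k < n) :
    shuffleAntisymmetrizer q (n + 1) (k + 1) =
      q ^ (k + 1) • shift q 0 (by omega) (shuffleAntisymmetrizer q n (k + 1)) +
      (-1 : 𝕜) ^ (n - k) • (shift q 0 (by omega) (shuffleAntisymmetrizer q n k) *
        descT q (n + 1) k (n - k)) := by
  rw [shuffleAntisymmetrizer,
    ← Finset.sum_filter_add_sum_filter_not _ (fun d => d (Fin.last n) = Fin.last n)]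
  congr 1
  · rw [shuffleAntisymmetrizer, map_sum, Finset.smul_sum]
    symm
    refine Finset.sum_bij (fun σ _ => extLast σ) ?_ ?_ ?_ ?_
    · intro σ hσ
      rw [Finset.mem_filter]
      refine ⟨?_, by simp⟩
      rw [mem_shuffles] at hσ ⊢
      intro i h hik
      have e1 : (⟨i, by omega⟩ : Fin (n + 1)) = Fin.castSucc ⟨i, by omega⟩ := rfl
      rw [e1, extLast_castSucc]
      by_cases hi : i + 1 < n
      · have e2 : (⟨i + 1, by omega⟩ : Fin (n + 1)) = Fin.castSucc ⟨i + 1, by omega⟩ := rfl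
        rw [e2, extLast_castSucc]
        simpa using hσ i hi hik
      · have e2 : (⟨i + 1, by omega⟩ : Fin (n + 1)) = Fin.last n := by
          ext; simp; omega
        rw [e2, extLast_last]
        exact Fin.castSucc_lt_last _
    · intro _ _ _ _ h
      exact extLast_injective h
    · intro d hd
      rw [Finset.mem_filter] at hd
      obtain ⟨σ, rfl⟩ := exists_extLast d hd.2
      refine ⟨σ, ?_, rfl⟩
      have hd := hd.1
      rw [mem_shuffles] at hd ⊢
      intro i h hik
      have := hd i (by omega) hik
      have e1 : (⟨i, by omega⟩ : Fin (n + 1)) = Fin.castSucc ⟨i, by omega⟩ := rfl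
      have e2 : (⟨i + 1, by omega⟩ : Fin (n + 1)) = Fin.castSucc ⟨i + 1, by omega⟩ := rfl
      rw [e1, e2, extLast_castSucc, extLast_castSucc] at this
      simpa using this
    · intro σ hσ
      rw [map_smul, T_extLast, smul_smul, len_extLast]
      congr 1
      have hl := len_le_of_mem_shuffles hσ
      have e : (k + 1) * (n + 1 - (k + 1)) - len σ = (k + 1) + ((k + 1) * (n - (k + 1)) - len σ) := by
        have : n + 1 - (k + 1) = (n - (k + 1)) + 1 := by omega
        rw [this, mul_add]
        omega
      rw [e, pow_add]
      ring
  · rw [shuffleAntisymmetrizer, map_sum, Finset.sum_mul, Finset.smul_sum]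
    symm
    refine Finset.sum_bij (fun σ _ => extLast σ * cyc (n + 1) k (n - k)) ?_ ?_ ?_ ?_
    · intro σ hσ
      obtain ⟨h1, -, -⟩ := cyc_spec q σ (n - k) k (by omega)
      rw [Finset.mem_filter]
      refine ⟨?_, ?_⟩
      · rw [mem_shuffles] at hσ ⊢
        intro i h hik
        rw [Fin.lt_def, h1, h1]
        simp only
        rcases Nat.lt_or_ge i k with hi | hi
        · rw [dif_pos hi]
          by_cases hi' : i + 1 < k
          · rw [dif_pos hi']
            exact hσ i (by omega) (by omega)
          · rw [dif_neg hi', dif_pos (by omega)]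
            exact (σ _).2
        · rw [dif_neg (by omega), dif_neg (by omega), dif_neg (by omega), dif_neg (by omega)]
          have := hσ (i - 1) (by omega) (by omega)
          have e : i - 1 + 1 = i := by omega
          simp only [e] at this
          exact this
      · intro hc
        have := congrArg Fin.val hc
        rw [h1] at this
        simp only [Fin.val_last] at this
        rw [dif_neg (by omega), dif_neg (by omega)] at this
        have := (σ ⟨n - 1, by omega⟩).2
        omega
    · intro _ _ _ _ h
      exact extLast_injective (mul_right_cancel h)
    · intro d hd
      rw [Finset.mem_filter] at hd
      obtain ⟨hd, hd'⟩ := hd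
      have hdk : (d ⟨k, by omega⟩ : ℕ) = n := by
        rw [mem_shuffles] at hd
        have hx : d (d⁻¹ (Fin.last n)) = Fin.last n := by simp
        have hx1 : d⁻¹ (Fin.last n) ≠ Fin.last n := fun h => hd' (by rwa [h] at hx)
        generalize d⁻¹ (Fin.last n) = x at hx hx1
        have hx2 : (x : ℕ) ≠ n := fun h => hx1 (Fin.ext h)
        by_contra hne
        have := hd x (by omega) (fun h => hne (by
          have : (⟨k, by omega⟩ : Fin (n + 1)) = x := Fin.ext (by simp only; omega)
          rw [this, hx]; rfl))
        simp only [Fin.eta, hx] at this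
        exact absurd this (not_lt.2 (Fin.le_last _))
      have hc1 : ∀ x : Fin (n + 1), (cyc (n + 1) k (n - k) x : ℕ) = if (x : ℕ) < k then (x : ℕ)
          else if (x : ℕ) = k then n else (x : ℕ) - 1 := by
        intro x
        have h1 := (cyc_spec q (1 : Equiv.Perm (Fin n)) (n - k) k (by omega)).1 x
        rw [extLast_one, one_mul] at h1
        rw [h1]
        split_ifs <;> rfl
      have hck : cyc (n + 1) k (n - k) ⟨k, by omega⟩ = Fin.last n := by
        ext
        rw [hc1]; simp
      obtain ⟨σ, hσ⟩ := exists_extLast (d * (cyc (n + 1) k (n - k))⁻¹) (by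
        rw [Equiv.Perm.mul_apply, ← hck, Equiv.Perm.inv_def, Equiv.symm_apply_apply, hck]
        exact Fin.ext hdk)
      have hσ' : extLast σ * cyc (n + 1) k (n - k) = d := by rw [hσ]; simp
      refine ⟨σ, ?_, hσ'⟩
      obtain ⟨h1, -, -⟩ := cyc_spec q σ (n - k) k (by omega)
      rw [hσ'] at h1
      rw [mem_shuffles] at hd ⊢
      intro i h hik
      rcases Nat.lt_or_ge i k with hi | hi
      · have := hd i (by omega) (by omega)
        rw [Fin.lt_def, h1, h1] at this
        simp only at this
        rw [dif_pos hi, dif_pos (by omega)] at this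
        exact this
      · have := hd (i + 1) (by omega) (by omega)
        rw [Fin.lt_def, h1, h1] at this
        simp only at this
        rw [dif_neg (by omega), dif_neg (by omega), dif_neg (by omega), dif_neg (by omega)] at this
        rw [Fin.lt_def]
        simpa only [Nat.add_sub_cancel] using this
    · intro σ hσ
      obtain ⟨-, h2, h3⟩ := cyc_spec q σ (n - k) k (by omega)
      rw [h2, h3, map_smul, T_extLast, smul_mul_assoc, smul_smul]
      congr 1
      have hl := len_le_of_mem_shuffles hσ
      have e : (k + 1) * (n + 1 - (k + 1)) - (len σ + (n - k)) = k * (n - k) - len σ := by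
        have : n + 1 - (k + 1) = n - k := by omega
        rw [this, add_mul]
        omega
      rw [e, pow_add]
      ring

end HeckeAlgebra
end

section

variable {𝕜 : Type*} [Field 𝕜]

namespace HeckeAlgebra

variable (q : 𝕜) {n : ℕ}

theorem g_comm (N i j : ℕ) (h : i + 1 < j) : g q N i * g q N j = g q N j * g q N i := by
  unfold g
  split_ifs
  · exact gen_comm q _ _ h
  all_goals simp

theorem g_braid (N i : ℕ) (h : i + 2 < N) :
    g q N i * g q N (i + 1) * g q N i = g q N (i + 1) * g q N i * g q N (i + 1) := by
  unfold g
  rw [dif_pos (by omega), dif_pos (by omega)]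
  exact gen_braid q _ _ rfl

theorem descT_succ' (N a m : ℕ) : descT q N a (m + 1) = g q N (a + m) * descT q N a m := by
  induction m generalizing a with
  | zero => simp [descT]
  | succ m ih =>
    rw [descT, ih, descT, mul_assoc]
    congr 2
    omega

theorem descT_add (N a m m' : ℕ) :
    descT q N a (m + m') = descT q N (a + m) m' * descT q N a m := by
  induction m' with
  | zero => simp [descT]
  | succ m' ih => rw [← add_assoc, descT_succ', ih, descT_succ', mul_assoc, add_assoc]

theorem descT_comm_lt (N a m i : ℕ) (h : i + 1 < a) :
    descT q N a m * g q N i = g q N i * descT q N a m := by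
  induction m with
  | zero => simp [descT]
  | succ m ih =>
    rw [descT_succ', mul_assoc, ih, ← mul_assoc, ← mul_assoc, g_comm q N i (a + m) (by omega)]

theorem descT_comm_gt (N a m i : ℕ) (h : a + m < i) :
    descT q N a m * g q N i = g q N i * descT q N a m := by
  induction m with
  | zero => simp [descT]
  | succ m ih =>
    rw [descT_succ', mul_assoc, ih (by omega), ← mul_assoc, ← mul_assoc,
      g_comm q N (a + m) i (by omega)]

theorem descT_mul_g (N a m j : ℕ) (haj : a ≤ j) (hj : j + 1 < a + m) (hN : a + m < N) :
    descT q N a m * g q N (j + 1) = g q N j * descT q N a m := by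
  induction m generalizing a with
  | zero => omega
  | succ m ih =>
    rcases Nat.lt_or_ge a j with h | h
    · rw [descT, mul_assoc, g_comm q N a (j + 1) (by omega), ← mul_assoc,
        ih (a + 1) (by omega) (by omega) (by omega), mul_assoc]
    · obtain rfl : a = j := le_antisymm haj h
      obtain ⟨m, rfl⟩ : ∃ p, m = p + 1 := ⟨m - 1, by omega⟩
      rw [descT, descT]
      calc descT q N (a + 1 + 1) m * g q N (a + 1) * g q N a * g q N (a + 1)
          = descT q N (a + 1 + 1) m * (g q N (a + 1) * g q N a * g q N (a + 1)) := by
            simp only [mul_assoc]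
        _ = (descT q N (a + 1 + 1) m * g q N a) * (g q N (a + 1) * g q N a) := by
            rw [← g_braid q N a (by omega)]; simp only [mul_assoc]
        _ = _ := by
            rw [descT_comm_lt q N _ _ a (by omega)]; simp only [mul_assoc]

theorem descT_mul_descT (N a m : ℕ) (hN : a + m + 1 < N) :
    descT q N a (m + 1) * descT q N (a + 1) m = descT q N a m * descT q N a (m + 1) := by
  have key : ∀ p, p ≤ m → descT q N a (m + 1) * descT q N (a + 1) p =
      descT q N a p * descT q N a (m + 1) := by
    intro p hp
    induction p with
    | zero => simp [descT]
    | succ p ih =>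
      rw [descT_succ' q N (a + 1) p, descT_succ' q N a p, ← mul_assoc,
        show a + 1 + p = a + p + 1 by omega,
        descT_mul_g q N a (m + 1) (a + p) (by omega) (by omega) (by omega), mul_assoc,
        ih (by omega), mul_assoc]
  exact key m le_rfl

theorem shift_g {n N : ℕ} (s : ℕ) (h : s + n ≤ N) (i : ℕ) (hi : i + 1 < n) :
    shift q s h (g q n i) = g q N (s + i) := by
  unfold g
  rw [dif_pos (by omega), dif_pos (by omega), shift_gen]

theorem shift_descT {n N : ℕ} (s : ℕ) (h : s + n ≤ N) (a m : ℕ) (ham : a + m < n) :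
    shift q s h (descT q n a m) = descT q N (s + a) m := by
  induction m generalizing a with
  | zero => simp [descT]
  | succ m ih =>
    rw [descT, map_mul, ih (a + 1) (by omega), shift_g q s h a (by omega), descT, add_assoc]

theorem induction_gen {n : ℕ} {C : HeckeAlgebra q n → Prop} (hs : ∀ r : 𝕜, C (algebraMap 𝕜 _ r))
    (hg : ∀ i, C (gen q i)) (hadd : ∀ x y, C x → C y → C (x + y))
    (hmul : ∀ x y, C x → C y → C (x * y)) (x : HeckeAlgebra q n) : C x := by
  obtain ⟨y, rfl⟩ := RingQuot.mkAlgHom_surjective 𝕜 (HeckeRel q n) x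
  induction y using FreeAlgebra.induction with
  | grade0 r => rw [AlgHom.commutes]; exact hs r
  | grade1 i => exact hg i
  | mul x y hx hy => rw [map_mul]; exact hmul _ _ hx hy
  | add x y hx hy => rw [map_add]; exact hadd _ _ hx hy

/-- The partial antisymmetrizer `y_{n/k,n-k}` shifted by `s` steps inside the algebra of rank
`N`. -/
def Ys (N s n k : ℕ) : HeckeAlgebra q N :=
  if h : s + n ≤ N then shift q s h (shuffleAntisymmetrizer q n k) else 1

theorem shift_self {n : ℕ} (h : 0 + n ≤ n) (x : HeckeAlgebra q n) : shift q 0 h x = x := by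
  have : shift q 0 h = AlgHom.id 𝕜 (HeckeAlgebra q n) := by
    apply hom_ext
    intro i
    simp [shift_gen]
  exact congrArg (fun f => f x) this

theorem Ys_eq (n k : ℕ) : Ys q n 0 n k = shuffleAntisymmetrizer q n k := by
  rw [Ys, dif_pos (by omega), shift_self]

theorem Ys_zero (N s n : ℕ) : Ys q N s n 0 = 1 := by
  simp [Ys, shuffleAntisymmetrizer_zero]

theorem Ys_self (N s n : ℕ) : Ys q N s n n = 1 := by
  simp [Ys, shuffleAntisymmetrizer_self]

theorem Ys_succ (N s n k' : ℕ) (hk : k' < n) (h : s + n < N) :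
    Ys q N s (n + 1) (k' + 1) = q ^ (k' + 1) • Ys q N s n (k' + 1) +
      (-1 : 𝕜) ^ (n - k') • (Ys q N s n k' * descT q N (s + k') (n - k')) := by
  unfold Ys
  rw [dif_pos (by omega), dif_pos (by omega), dif_pos (by omega), shuffleAntisymmetrizer_succ q n k' hk]
  rw [map_add, map_smul, map_smul, map_mul, shift_shift, shift_shift,
    shift_descT q s _ _ _ (by omega)]
  rfl

theorem descT_comm_shift {n N : ℕ} (s a m : ℕ) (h : s + n ≤ N) (h' : s + n ≤ a)
    (x : HeckeAlgebra q n) :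
    descT q N a m * shift q s h x = shift q s h x * descT q N a m := by
  induction x using induction_gen with
  | hs r => rw [AlgHom.commutes]; exact (Algebra.commutes _ _).symm
  | hg i =>
    have := descT_comm_lt q N a m (s + i) (by omega)
    rw [shift_gen]
    simpa only [g, dif_pos (show s + (i : ℕ) < N - 1 by omega)] using this
  | hadd x y hx hy => rw [map_add, mul_add, add_mul, hx, hy]
  | hmul x y hx hy => rw [map_mul, ← mul_assoc, hx, mul_assoc, hy, mul_assoc]

theorem descT_mul_shift {n N : ℕ} (a : ℕ) (h : a + 1 + n ≤ N) (x : HeckeAlgebra q n) :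
    descT q N a n * shift q (a + 1) h x = shift q a (by omega) x * descT q N a n := by
  induction x using induction_gen with
  | hs r => rw [AlgHom.commutes, AlgHom.commutes]; exact (Algebra.commutes _ _).symm
  | hg i =>
    have := descT_mul_g q N a n (a + i) (by omega) (by omega) (by omega)
    rw [shift_gen, shift_gen]
    simp only [g, dif_pos (show a + (i : ℕ) < N - 1 by omega),
      dif_pos (show a + (i : ℕ) + 1 < N - 1 by omega)] at this
    simpa only [add_right_comm a 1] using this
  | hadd x y hx hy => rw [map_add, map_add, mul_add, add_mul, hx, hy]
  | hmul x y hx hy => rw [map_mul, map_mul, ← mul_assoc, hx, mul_assoc, hy, mul_assoc]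

theorem descT_comm_Ys (N s n k' a m : ℕ) (h' : s + n ≤ a) :
    descT q N a m * Ys q N s n k' = Ys q N s n k' * descT q N a m := by
  unfold Ys
  split_ifs with h
  · exact descT_comm_shift q s a m h h' _
  · simp

theorem descT_mul_Ys (N n k' a : ℕ) (h : a + 1 + n ≤ N) :
    descT q N a n * Ys q N (a + 1) n k' = Ys q N a n k' * descT q N a n := by
  unfold Ys
  rw [dif_pos h, dif_pos (by omega)]
  exact descT_mul_shift q a h _

theorem Ys_assoc (N a b c : ℕ) (h : a + b + c ≤ N) :
    Ys q N 0 (a + b + c) (a + b) * Ys q N 0 (a + b) a =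
      Ys q N 0 (a + b + c) a * Ys q N a (b + c) b := by
  induction hn : a + b + c using Nat.strong_induction_on generalizing a b c with
  | _ n ih =>
  subst hn
  obtain _ | a := a
  · simp [Ys_zero]
  obtain _ | b := b
  · simp [Ys_zero, Ys_self]
  obtain _ | c := c
  · simp [Ys_self]
  have i1 := ih _ (by omega) (a + 1) (b + 1) c (by omega) rfl
  have i2 := ih _ (by omega) (a + 1) b (c + 1) (by omega) rfl
  have i3 := ih _ (by omega) a (b + 1) (c + 1) (by omega) rfl
  have e1 := Ys_succ q N 0 (a + b + c + 2) (a + b + 1) (by omega) (by omega)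
  have e2 := Ys_succ q N 0 (a + b + 1) a (by omega) (by omega)
  have e3 := Ys_succ q N 0 (a + b + c + 2) a (by omega) (by omega)
  have e4 := Ys_succ q N (a + 1) (b + c + 1) b (by omega) (by omega)
  have d1 := descT_comm_Ys q N 0 (a + b + 1) (a + 1) (a + b + 1) (c + 1) (by omega)
  have d2 := descT_comm_Ys q N 0 (a + b + 1) a (a + b + 1) (c + 1) (by omega)
  have d3 := descT_mul_Ys q N (b + c + 2) (b + 1) a (by omega)
  have d4 := descT_add q N a (b + 1) (c + 1)
  simp only [show a + 1 + (b + 1) = a + b + 2 by omega, show a + 1 + b = a + b + 1 by omega,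
    show a + (b + 1) = a + b + 1 by omega, show b + 1 + (c + 1) = b + c + 2 by omega,
    show a + b + 2 + (c + 1) = a + b + c + 3 by omega,
    show a + b + 2 + c = a + b + c + 2 by omega,
    show a + b + 1 + (c + 1) = a + b + c + 2 by omega,
    show b + 1 + c = b + c + 1 by omega, show b + (c + 1) = b + c + 1 by omega,
    show a + b + c + 2 + 1 = a + b + c + 3 by omega,
    show a + b + 1 + 1 = a + b + 2 by omega,
    show b + c + 1 + 1 = b + c + 2 by omega,
    show a + b + c + 2 - (a + b + 1) = c + 1 by omega,
    show a + b + 1 - a = b + 1 by omega,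
    show a + b + c + 2 - a = b + c + 2 by omega,
    show b + c + 1 - b = c + 1 by omega, zero_add] at i1 i2 i3 e1 e2 e3 e4 d1 d2 d3 d4 ⊢
  have L : Ys q N 0 (a + b + c + 3) (a + b + 2) * Ys q N 0 (a + b + 2) (a + 1) =
      q ^ (a + b + 2) • (Ys q N 0 (a + b + c + 2) (a + b + 2) * Ys q N 0 (a + b + 2) (a + 1)) +
      ((-1 : 𝕜) ^ (c + 1) * q ^ (a + 1)) • (Ys q N 0 (a + b + c + 2) (a + b + 1) *
        Ys q N 0 (a + b + 1) (a + 1) * descT q N (a + b + 1) (c + 1)) +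
      ((-1 : 𝕜) ^ (c + 1) * (-1 : 𝕜) ^ (b + 1)) • (Ys q N 0 (a + b + c + 2) (a + b + 1) *
        Ys q N 0 (a + b + 1) a * descT q N a (b + c + 2)) := by
    rw [e1, add_mul, smul_mul_assoc, smul_mul_assoc, add_assoc (q ^ (a + b + 2) • _)]
    congr 1
    rw [e2, mul_add, mul_smul_comm, mul_smul_comm, smul_add, smul_smul, smul_smul, d4]
    congr 2
    · rw [mul_assoc, d1, mul_assoc]
    · rw [mul_assoc, ← mul_assoc (descT q N (a + b + 1) (c + 1)), d2]
      simp only [mul_assoc]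
  have R : Ys q N 0 (a + b + c + 3) (a + 1) * Ys q N (a + 1) (b + c + 2) (b + 1) =
      (q ^ (a + 1) * q ^ (b + 1)) •
        (Ys q N 0 (a + b + c + 2) (a + 1) * Ys q N (a + 1) (b + c + 1) (b + 1)) +
      (q ^ (a + 1) * (-1 : 𝕜) ^ (c + 1)) • (Ys q N 0 (a + b + c + 2) (a + 1) *
        Ys q N (a + 1) (b + c + 1) b * descT q N (a + b + 1) (c + 1)) +
      (-1 : 𝕜) ^ (b + c + 2) • (Ys q N 0 (a + b + c + 2) a *
        Ys q N a (b + c + 2) (b + 1) * descT q N a (b + c + 2)) := by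
    rw [e3, add_mul, smul_mul_assoc, smul_mul_assoc]
    congr 1
    · rw [e4, mul_add, mul_smul_comm, mul_smul_comm, smul_add, smul_smul, smul_smul]
      simp only [mul_assoc]
    · rw [mul_assoc, d3, mul_assoc]
  rw [L, R, i1, i2, i3]
  congr 2
  · congr 1
    ring
  · congr 1
    ring
  · ring

section range

variable {N : ℕ} {M : Type*} [AddCommGroup M] [Module 𝕜 M]
  (ρ : HeckeAlgebra q N →ₐ[𝕜] Module.End 𝕜 M)

/-- The subspace `(T_j - q) M` of a left module. -/
def imG (j : ℕ) : Submodule 𝕜 M := LinearMap.range (ρ (g q N j - algebraMap 𝕜 _ q))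

theorem mem_imG_of {i j : ℕ} {x x' : HeckeAlgebra q N} {u : M} (hu : u ∈ imG q ρ j)
    (h : x * (g q N j - algebraMap 𝕜 _ q) = (g q N i - algebraMap 𝕜 _ q) * x') :
    ρ x u ∈ imG q ρ i := by
  obtain ⟨w, rfl⟩ := hu
  refine ⟨ρ x' w, ?_⟩
  rw [← Module.End.mul_apply, ← Module.End.mul_apply, ← map_mul, ← map_mul, h]

theorem mem_imG_of' {i j : ℕ} {x : HeckeAlgebra q N} {u : M} (hu : u ∈ imG q ρ j)
    (h : x * g q N j = g q N i * x) : ρ x u ∈ imG q ρ i :=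
  mem_imG_of q ρ hu (x' := x) (by
    rw [mul_sub, sub_mul, h, Algebra.commutes])

theorem Ys_comm_g (n k' i : ℕ) (hi : n ≤ i) : Ys q N 0 n k' * g q N i = g q N i * Ys q N 0 n k' := by
  have := descT_comm_Ys q N 0 n k' i 1 (by omega)
  simpa [descT] using this.symm

theorem Ys_mem_imG (n k' : ℕ) (hn : n ≤ N) (hk : k' ≤ n) (u : M)
    (hu : ∀ j, j + 1 < n → j + 1 ≠ k' → u ∈ imG q ρ j) (i : ℕ) (hi : i + 1 < n) :
    ρ (Ys q N 0 n k') u ∈ imG q ρ i := by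
  induction n generalizing k' u i with
  | zero => omega
  | succ n ih =>
    obtain _ | k' := k'
    · rw [Ys_zero, map_one]
      exact hu i hi (by omega)
    rcases Nat.lt_or_ge k' n with hkn | hkn
    swap
    · obtain rfl : k' = n := by omega
      rw [Ys_self, map_one]
      exact hu i hi (by omega)
    rcases Nat.lt_or_ge (i + 1) n with hin | hin
    · rw [Ys_succ q N 0 n k' hkn (by omega), map_add, map_smul, map_smul, map_mul, zero_add]
      refine Submodule.add_mem _ (Submodule.smul_mem _ _ ?_) (Submodule.smul_mem _ _ ?_)
      · exact ih _ (by omega) (by omega) u (fun j hj hjk => hu j (by omega) hjk) i hin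
      · refine ih _ (by omega) (by omega) _ (fun j hj hjk => ?_) i hin
        rcases Nat.lt_or_ge j k' with h | h
        · exact mem_imG_of' q ρ (hu j (by omega) (by omega))
            (descT_comm_lt q N _ _ _ (by omega))
        · exact mem_imG_of' q ρ (hu (j + 1) (by omega) (by omega))
            (descT_mul_g q N _ _ _ h (by omega) (by omega))
    · obtain ⟨p, rfl⟩ : ∃ p, n = p + 1 := ⟨n - 1, by omega⟩
      obtain rfl : i = p := by omega
      -- split off the first term of the expansion
      have hA : ∃ A : HeckeAlgebra q N, ρ A u ∈ imG q ρ i ∧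
          Ys q N 0 (i + 1) (k' + 1) =
            A + (-1 : 𝕜) ^ (i - k') • (Ys q N 0 i k' * descT q N k' (i - k')) := by
        rcases Nat.lt_or_ge k' i with h | h
        · refine ⟨q ^ (k' + 1) • Ys q N 0 i (k' + 1), ?_, ?_⟩
          · rw [map_smul]
            exact Submodule.smul_mem _ _ (mem_imG_of' q ρ (hu i (by omega) (by omega))
              (Ys_comm_g q i _ _ le_rfl))
          · rw [Ys_succ q N 0 i k' h (by omega), zero_add]
        · obtain rfl : k' = i := by omega
          refine ⟨0, by simp, ?_⟩
          simp [Ys_self, descT]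
      obtain ⟨A, hA1, hA2⟩ := hA
      have hB : ∃ B : HeckeAlgebra q N, ρ (B * descT q N k' (i + 1 - k')) u ∈ imG q ρ i ∧
          Ys q N 0 (i + 1) k' = B + q ^ k' • Ys q N 0 i k' := by
        obtain _ | a := k'
        · exact ⟨0, by simp, by simp [Ys_zero]⟩
        · refine ⟨_, ?_, (Ys_succ q N 0 i a (by omega) (by omega)).trans (add_comm _ _)⟩
          rw [smul_mul_assoc, map_smul]
          refine Submodule.smul_mem _ _ ?_
          rw [zero_add, mul_assoc, map_mul]
          refine mem_imG_of' q ρ (j := i) ?_ (Ys_comm_g q i _ _ le_rfl)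
          refine mem_imG_of' q ρ (hu a (by omega) (by omega)) ?_
          obtain ⟨m, rfl⟩ : ∃ m, i = a + m := ⟨i - a, by omega⟩
          have e1 : a + m - a = m := by omega
          have e2 : a + m + 1 - (a + 1) = m := by omega
          rw [e1, e2, mul_assoc, ← descT, ← mul_assoc, ← descT_succ']
          exact (descT_mul_descT q N a m (by omega)).symm
      obtain ⟨B, hB1, hB2⟩ := hB
      have e : Ys q N 0 (i + 1 + 1) (k' + 1) = q ^ (k' + 1) • A +
          (-1 : 𝕜) ^ (i + 1 - k') • (B * descT q N k' (i + 1 - k')) +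
          ((-1 : 𝕜) ^ (i + 1 - k') * q ^ k') • ((g q N i - algebraMap 𝕜 _ q) *
            (Ys q N 0 i k' * descT q N k' (i - k'))) := by
        rw [Ys_succ q N 0 (i + 1) k' hkn (by omega), hA2, hB2, zero_add]
        have e1 : i + 1 - k' = (i - k') + 1 := by omega
        have e2 : descT q N k' (i - k' + 1) = g q N i * descT q N k' (i - k') := by
          rw [descT_succ']; congr 2; omega
        have e3 : (g q N i - algebraMap 𝕜 _ q) * (Ys q N 0 i k' * descT q N k' (i - k')) =
            Ys q N 0 i k' * (g q N i * descT q N k' (i - k')) -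
              q • (Ys q N 0 i k' * descT q N k' (i - k')) := by
          rw [sub_mul, ← mul_assoc, ← Ys_comm_g q i k' i le_rfl, mul_assoc, Algebra.smul_def]
        rw [e3, e1, e2, add_mul, smul_mul_assoc]
        module
      rw [e, map_add, map_add, map_smul, map_smul, map_smul]
      refine Submodule.add_mem _ (Submodule.add_mem _ (Submodule.smul_mem _ _ hA1)
        (Submodule.smul_mem _ _ hB1)) (Submodule.smul_mem _ _ ?_)
      rw [map_mul]
      exact LinearMap.mem_range_self _ _

end range

end HeckeAlgebra
end

/-! ### Hecke symmetries -/

section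

variable {𝕜 V : Type*} [Field 𝕜] [AddCommGroup V] [Module 𝕜 V]

variable (𝕜 V) in
/-- A Hecke symmetry on `V` with parameter `q ≠ 0`: a linear operator on `V ⊗ V` satisfying the
braid equation and the quadratic Hecke relation. -/
structure HeckeSymmetry where
  /-- the operator -/
  R : V ⊗[𝕜] V →ₗ[𝕜] V ⊗[𝕜] V
  /-- the parameter -/
  q : 𝕜
  q_ne_zero : q ≠ 0
  braid :
    R.rTensor V ∘ₗ ((TensorProduct.assoc 𝕜 V V V).symm.toLinearMap ∘ₗ R.lTensor V ∘ₗ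
      (TensorProduct.assoc 𝕜 V V V).toLinearMap) ∘ₗ R.rTensor V =
    ((TensorProduct.assoc 𝕜 V V V).symm.toLinearMap ∘ₗ R.lTensor V ∘ₗ
      (TensorProduct.assoc 𝕜 V V V).toLinearMap) ∘ₗ R.rTensor V ∘ₗ
      ((TensorProduct.assoc 𝕜 V V V).symm.toLinearMap ∘ₗ R.lTensor V ∘ₗ
      (TensorProduct.assoc 𝕜 V V V).toLinearMap)
  hecke : (R - q • LinearMap.id) ∘ₗ (R + LinearMap.id) = 0

open PiTensorProduct in
/-- The linear map sending `x ⊗ y` to the pure tensor `v_0 ⊗ ⋯ ⊗ v_{n-1}` with the entries in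
positions `i, i + 1` replaced by `x, y`. -/
def ins {n : ℕ} (i : Fin (n - 1)) (v : Fin n → V) : V ⊗[𝕜] V →ₗ[𝕜] ⨂[𝕜]^n V :=
  TensorProduct.lift (LinearMap.mk₂ 𝕜
    (fun x y => tprod 𝕜 (Function.update (Function.update v ⟨i, by omega⟩ x) ⟨i + 1, by omega⟩ y))
    (fun x x' y => by
      simp only [Function.update_comm (show (⟨i, by omega⟩ : Fin n) ≠ ⟨i + 1, by omega⟩ by
        simp [Fin.ext_iff]), MultilinearMap.map_update_add])
    (fun c x y => by
      simp only [Function.update_comm (show (⟨i, by omega⟩ : Fin n) ≠ ⟨i + 1, by omega⟩ by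
        simp [Fin.ext_iff]), MultilinearMap.map_update_smul])
    (fun x y y' => by simp only [MultilinearMap.map_update_add])
    (fun c x y => by simp only [MultilinearMap.map_update_smul]))

open PiTensorProduct in
theorem ins_tmul {n : ℕ} (i : Fin (n - 1)) (v : Fin n → V) (x y : V) :
    ins (𝕜 := 𝕜) i v (x ⊗ₜ y) = tprod 𝕜 (Function.update (Function.update v ⟨i, by omega⟩ x)
      ⟨i + 1, by omega⟩ y) := rfl

open PiTensorProduct in
theorem ins_self {n : ℕ} (i : Fin (n - 1)) (v : Fin n → V) :
    ins (𝕜 := 𝕜) i v (v ⟨i, by omega⟩ ⊗ₜ v ⟨i + 1, by omega⟩) = tprod 𝕜 v := by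
  rw [ins_tmul, Function.update_eq_self, Function.update_eq_self]

theorem ins_congr {n : ℕ} (i : Fin (n - 1)) (v w : Fin n → V)
    (h : ∀ l : Fin n, (l : ℕ) ≠ i → (l : ℕ) ≠ i + 1 → v l = w l) :
    ins (𝕜 := 𝕜) i v = ins i w := by
  ext x y
  simp only [TensorProduct.AlgebraTensorModule.curry_apply, LinearMap.restrictScalars_self,
    TensorProduct.curry_apply, ins_tmul]
  congr 1
  funext l
  simp only [Function.update_apply, Fin.ext_iff]
  split_ifs with h1 h2
  · rfl
  · rfl
  · exact h l h2 h1

theorem ins_update_add {n : ℕ} (i : Fin (n - 1)) (v : Fin n → V) (j : Fin n) (hj : (j : ℕ) ≠ i)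
    (hj' : (j : ℕ) ≠ i + 1) (x y : V) : ins (𝕜 := 𝕜) i (Function.update v j (x + y)) =
      ins i (Function.update v j x) + ins i (Function.update v j y) := by
  ext a b
  simp only [TensorProduct.AlgebraTensorModule.curry_apply, LinearMap.restrictScalars_self,
    TensorProduct.curry_apply, LinearMap.add_apply, ins_tmul]
  simp only [Function.update_comm (show j ≠ (⟨i, by omega⟩ : Fin n) by simpa [Fin.ext_iff]),
    Function.update_comm (show j ≠ (⟨i + 1, by omega⟩ : Fin n) by simpa [Fin.ext_iff]),
    MultilinearMap.map_update_add]

theorem ins_update_smul {n : ℕ} (i : Fin (n - 1)) (v : Fin n → V) (j : Fin n) (hj : (j : ℕ) ≠ i)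
    (hj' : (j : ℕ) ≠ i + 1) (c : 𝕜) (x : V) : ins (𝕜 := 𝕜) i (Function.update v j (c • x)) =
      c • ins i (Function.update v j x) := by
  ext a b
  simp only [TensorProduct.AlgebraTensorModule.curry_apply, LinearMap.restrictScalars_self,
    TensorProduct.curry_apply, LinearMap.smul_apply, ins_tmul]
  simp only [Function.update_comm (show j ≠ (⟨i, by omega⟩ : Fin n) by simpa [Fin.ext_iff]),
    Function.update_comm (show j ≠ (⟨i + 1, by omega⟩ : Fin n) by simpa [Fin.ext_iff]),
    MultilinearMap.map_update_smul]

/-- `ins` on three consecutive positions `i, i + 1, i + 2`. -/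
def ins3 {n : ℕ} (i : Fin (n - 1)) (hi : (i : ℕ) + 2 < n) (v : Fin n → V) :
    (V ⊗[𝕜] V) ⊗[𝕜] V →ₗ[𝕜] ⨂[𝕜]^n V :=
  TensorProduct.lift (LinearMap.mk₂ 𝕜 (fun t z => ins i (Function.update v ⟨i + 2, hi⟩ z) t)
    (fun _ _ _ => map_add _ _ _) (fun _ _ _ => map_smul _ _ _)
    (fun t z z' => by
      rw [ins_update_add i v _ (by simp) (by simp)]; rfl)
    (fun c t z => by
      rw [ins_update_smul i v _ (by simp) (by simp)]; rfl))

theorem ins3_tmul {n : ℕ} (i : Fin (n - 1)) (hi : (i : ℕ) + 2 < n) (v : Fin n → V)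
    (t : V ⊗[𝕜] V) (z : V) :
    ins3 (𝕜 := 𝕜) i hi v (t ⊗ₜ z) = ins i (Function.update v ⟨i + 2, hi⟩ z) t := rfl

namespace HeckeSymmetry

variable (H : HeckeSymmetry 𝕜 V)

open PiTensorProduct in
/-- The operator `Id^{⊗ i} ⊗ R ⊗ Id^{⊗ (n - i - 2)}` on `V^{⊗ n}`. -/
def act (n : ℕ) (i : Fin (n - 1)) : Module.End 𝕜 (⨂[𝕜]^n V) :=
  PiTensorProduct.lift
    { toFun := fun v => ins i v (H.R (v ⟨i, by omega⟩ ⊗ₜ v ⟨i + 1, by omega⟩))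
      map_update_add' := by
        have hi0 : (i : ℕ) < n := by omega
        have hi1 : (i : ℕ) + 1 < n := by omega
        intro inst v j x y
        obtain rfl := Subsingleton.elim inst (instDecidableEqFin n)
        by_cases h1 : (j : ℕ) = i
        · obtain rfl : j = ⟨i, hi0⟩ := Fin.ext h1
          have e : ∀ z, ins (𝕜 := 𝕜) i (Function.update v ⟨i, hi0⟩ z) = ins i v := fun z =>
            ins_congr i _ _ fun l hl hl' => Function.update_of_ne (by simpa [Fin.ext_iff]) _ _
          simp [e, TensorProduct.add_tmul]
        by_cases h2 : (j : ℕ) = i + 1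
        · obtain rfl : j = ⟨i + 1, hi1⟩ := Fin.ext h2
          have e : ∀ z, ins (𝕜 := 𝕜) i (Function.update v ⟨i + 1, hi1⟩ z) = ins i v := fun z =>
            ins_congr i _ _ fun l hl hl' => Function.update_of_ne (by simpa [Fin.ext_iff]) _ _
          simp [e, TensorProduct.tmul_add]
        · rw [ins_update_add i v j h1 h2]
          have e1 : (⟨i, hi0⟩ : Fin n) ≠ j := fun h => h1 (by rw [← h])
          have e2 : (⟨i + 1, hi1⟩ : Fin n) ≠ j := fun h => h2 (by rw [← h])
          simp [Function.update_of_ne e1, Function.update_of_ne e2]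
      map_update_smul' := by
        have hi0 : (i : ℕ) < n := by omega
        have hi1 : (i : ℕ) + 1 < n := by omega
        intro inst v j c x
        obtain rfl := Subsingleton.elim inst (instDecidableEqFin n)
        by_cases h1 : (j : ℕ) = i
        · obtain rfl : j = ⟨i, hi0⟩ := Fin.ext h1
          have e : ∀ z, ins (𝕜 := 𝕜) i (Function.update v ⟨i, hi0⟩ z) = ins i v := fun z =>
            ins_congr i _ _ fun l hl hl' => Function.update_of_ne (by simpa [Fin.ext_iff]) _ _
          simp [e, ← TensorProduct.smul_tmul']
        by_cases h2 : (j : ℕ) = i + 1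
        · obtain rfl : j = ⟨i + 1, hi1⟩ := Fin.ext h2
          have e : ∀ z, ins (𝕜 := 𝕜) i (Function.update v ⟨i + 1, hi1⟩ z) = ins i v := fun z =>
            ins_congr i _ _ fun l hl hl' => Function.update_of_ne (by simpa [Fin.ext_iff]) _ _
          simp [e]
        · rw [ins_update_smul i v j h1 h2]
          have e1 : (⟨i, hi0⟩ : Fin n) ≠ j := fun h => h1 (by rw [← h])
          have e2 : (⟨i + 1, hi1⟩ : Fin n) ≠ j := fun h => h2 (by rw [← h])
          simp [Function.update_of_ne e1, Function.update_of_ne e2] }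

theorem act_tprod (n : ℕ) (i : Fin (n - 1)) (v : Fin n → V) :
    H.act n i (PiTensorProduct.tprod 𝕜 v) =
      ins i v (H.R (v ⟨i, by omega⟩ ⊗ₜ v ⟨i + 1, by omega⟩)) := by
  rw [act, PiTensorProduct.lift.tprod]
  rfl

theorem act_ins (n : ℕ) (i : Fin (n - 1)) (v : Fin n → V) (t : V ⊗[𝕜] V) :
    H.act n i (ins i v t) = ins i v (H.R t) := by
  induction t with
  | zero => simp
  | add x y hx hy => simp only [map_add, hx, hy]
  | tmul x y =>
    rw [ins_tmul, act_tprod]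
    rw [ins_congr i (Function.update (Function.update v _ x) _ y) v]
    · simp
    · intro l h1 h2
      rw [Function.update_of_ne (by simpa [Fin.ext_iff]),
        Function.update_of_ne (by simpa [Fin.ext_iff])]

theorem act_quad (n : ℕ) (i : Fin (n - 1)) :
    (H.act n i - algebraMap 𝕜 _ H.q) * (H.act n i + 1) = 0 := by
  apply PiTensorProduct.ext
  ext v
  have := congrArg (fun f => ins i v (f (v ⟨i, by omega⟩ ⊗ₜ v ⟨i + 1, by omega⟩))) H.hecke
  simp only [LinearMap.comp_apply, LinearMap.sub_apply, LinearMap.add_apply, LinearMap.smul_apply,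
    LinearMap.id_apply, LinearMap.zero_apply, map_zero] at this
  simp only [LinearMap.compMultilinearMap_apply, Module.End.mul_apply, LinearMap.sub_apply,
    LinearMap.add_apply, Module.algebraMap_end_apply, Module.End.one_apply, LinearMap.zero_apply]
  rw [← ins_self i v, act_ins, ← map_add, act_ins, ← map_smul, ← map_sub]
  exact this

theorem act_comm (n : ℕ) (i j : Fin (n - 1)) (h : (i : ℕ) + 1 < j) :
    H.act n i * H.act n j = H.act n j * H.act n i := by
  apply PiTensorProduct.ext
  ext v
  simp only [LinearMap.compMultilinearMap_apply, Module.End.mul_apply, act_tprod]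
  have key : ∀ (i j : Fin (n - 1)) (s t : V ⊗[𝕜] V) (S T : Finset (V × V)),
      ((i : ℕ) + 1 < j ∨ (j : ℕ) + 1 < i) →
      s = H.R (v ⟨i, by omega⟩ ⊗ₜ v ⟨i + 1, by omega⟩) → s = ∑ p ∈ S, p.1 ⊗ₜ p.2 →
      t = ∑ p ∈ T, p.1 ⊗ₜ p.2 →
      H.act n i (ins j v t) = ∑ p ∈ T, ∑ r ∈ S, PiTensorProduct.tprod 𝕜 (fun l : Fin n =>
        if (l : ℕ) = i then r.1 else if (l : ℕ) = i + 1 then r.2 else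
        if (l : ℕ) = j then p.1 else if (l : ℕ) = j + 1 then p.2 else v l) := by
    intro i j s t S T hij hs hS hT
    rw [hT, map_sum, map_sum]
    refine Finset.sum_congr rfl fun p _ => ?_
    rw [ins_tmul, act_tprod]
    rw [Function.update_of_ne (by simp [Fin.ext_iff]; omega),
      Function.update_of_ne (by simp [Fin.ext_iff]; omega),
      Function.update_of_ne (by simp [Fin.ext_iff]; omega),
      Function.update_of_ne (by simp [Fin.ext_iff]; omega), ← hs, hS, map_sum]
    refine Finset.sum_congr rfl fun r _ => ?_
    rw [ins_tmul]
    congr 1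
    funext l
    simp only [Function.update_apply, Fin.ext_iff]
    split_ifs <;> first | rfl | omega
  obtain ⟨S, hS⟩ := TensorProduct.exists_finset (H.R (v ⟨i, by omega⟩ ⊗ₜ v ⟨i + 1, by omega⟩))
  obtain ⟨T, hT⟩ := TensorProduct.exists_finset (H.R (v ⟨j, by omega⟩ ⊗ₜ v ⟨j + 1, by omega⟩))
  rw [key i j _ _ S T (.inl h) rfl hS hT, key j i _ _ T S (.inr h) rfl hT hS, Finset.sum_comm]
  refine Finset.sum_congr rfl fun p _ => Finset.sum_congr rfl fun r _ => ?_
  congr 1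
  funext l
  split_ifs <;> first | rfl | omega

theorem act_ins3 (n : ℕ) (i : Fin (n - 1)) (hi : (i : ℕ) + 2 < n) (v : Fin n → V)
    (u : (V ⊗[𝕜] V) ⊗[𝕜] V) :
    H.act n i (ins3 i hi v u) = ins3 i hi v (H.R.rTensor V u) := by
  induction u with
  | zero => simp
  | add x y hx hy => simp only [map_add, hx, hy]
  | tmul t z => rw [ins3_tmul, act_ins, LinearMap.rTensor_tmul, ins3_tmul]

theorem act_ins3' (n : ℕ) (i j : Fin (n - 1)) (hi : (i : ℕ) + 2 < n) (hj : (i : ℕ) + 1 = j)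
    (v : Fin n → V) (u : (V ⊗[𝕜] V) ⊗[𝕜] V) :
    H.act n j (ins3 i hi v u) = ins3 i hi v
      (((TensorProduct.assoc 𝕜 V V V).symm.toLinearMap ∘ₗ H.R.lTensor V ∘ₗ
        (TensorProduct.assoc 𝕜 V V V).toLinearMap) u) := by
  induction u with
  | zero => simp
  | add x y hx hy => rw [map_add, map_add, map_add, map_add, hx, hy]
  | tmul t z =>
    induction t with
    | zero => simp
    | add x y hx hy => rw [TensorProduct.add_tmul, map_add, map_add, map_add, map_add, hx, hy]
    | tmul x y =>
      rw [ins3_tmul, ins_tmul, act_tprod]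
      simp only [LinearMap.comp_apply, LinearEquiv.coe_coe, TensorProduct.assoc_tmul,
        LinearMap.lTensor_tmul]
      have e1 : (⟨j, by omega⟩ : Fin n) = ⟨i + 1, by omega⟩ := Fin.ext hj.symm
      have e2 : (⟨j + 1, by omega⟩ : Fin n) = ⟨i + 2, by omega⟩ := Fin.ext (by simp only; omega)
      rw [e1, e2, Function.update_self, Function.update_of_ne (by simp [Fin.ext_iff]),
        Function.update_of_ne (by simp [Fin.ext_iff]), Function.update_self]
      generalize H.R (y ⊗ₜ z) = t
      induction t with
      | zero => simp
      | add x y hx hy => rw [TensorProduct.tmul_add, map_add, map_add, map_add, hx, hy]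
      | tmul y' z' =>
        rw [TensorProduct.assoc_symm_tmul, ins3_tmul, ins_tmul, ins_tmul, e1, e2]
        congr 1
        funext l
        simp only [Function.update_apply, Fin.ext_iff]
        split_ifs <;> first | rfl | omega

theorem act_braid (n : ℕ) (i j : Fin (n - 1)) (hj : (i : ℕ) + 1 = j) :
    H.act n i * H.act n j * H.act n i = H.act n j * H.act n i * H.act n j := by
  apply PiTensorProduct.ext
  ext v
  have hi : (i : ℕ) + 2 < n := by omega
  simp only [LinearMap.compMultilinearMap_apply, Module.End.mul_apply]
  have e : PiTensorProduct.tprod 𝕜 v =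
      ins3 i hi v ((v ⟨i, by omega⟩ ⊗ₜ v ⟨i + 1, by omega⟩) ⊗ₜ v ⟨i + 2, hi⟩) := by
    rw [ins3_tmul, Function.update_eq_self, ins_self]
  rw [e]
  simp only [act_ins3, act_ins3' H n i j hi hj]
  have := congrArg (fun f => f ((v ⟨i, by omega⟩ ⊗ₜ v ⟨i + 1, by omega⟩) ⊗ₜ v ⟨i + 2, hi⟩)) H.braid
  exact congrArg (ins3 i hi v) this

/-- The representation of the Hecke algebra in the `n`th tensor power of `V`. -/
def rep (n : ℕ) : HeckeAlgebra H.q n →ₐ[𝕜] Module.End 𝕜 (⨂[𝕜]^n V) :=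
  HeckeAlgebra.lift H.q (H.act n) (H.act_braid n) (H.act_comm n) (H.act_quad n)

theorem rep_gen (n : ℕ) (i : Fin (n - 1)) : H.rep n (HeckeAlgebra.gen H.q i) = H.act n i :=
  HeckeAlgebra.lift_gen ..

end HeckeSymmetry
end

/-! ### The algebras `Υ(V, R)` and `Λ(V, R)` -/

section

variable {𝕜 V : Type*} [Field 𝕜] [AddCommGroup V] [Module 𝕜 V]

/-- The product `ab = a ⊗ b` of homogeneous tensors. -/
def tmul {m n : ℕ} (a : ⨂[𝕜]^m V) (b : ⨂[𝕜]^n V) : ⨂[𝕜]^(m + n) V :=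
  TensorPower.mulEquiv (a ⊗ₜ b)

theorem tmul_tprod {m n : ℕ} (v : Fin m → V) (w : Fin n → V) :
    tmul (PiTensorProduct.tprod 𝕜 v) (PiTensorProduct.tprod 𝕜 w) =
      PiTensorProduct.tprod 𝕜 (Fin.append v w) := TensorPower.tprod_mul_tprod 𝕜 v w

theorem add_tmul {m n : ℕ} (a a' : ⨂[𝕜]^m V) (b : ⨂[𝕜]^n V) :
    tmul (a + a') b = tmul a b + tmul a' b := by
  rw [tmul, TensorProduct.add_tmul, map_add]; rfl

theorem tmul_add {m n : ℕ} (a : ⨂[𝕜]^m V) (b b' : ⨂[𝕜]^n V) :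
    tmul a (b + b') = tmul a b + tmul a b' := by
  rw [tmul, TensorProduct.tmul_add, map_add]; rfl

theorem smul_tmul {m n : ℕ} (c : 𝕜) (a : ⨂[𝕜]^m V) (b : ⨂[𝕜]^n V) :
    tmul (c • a) b = c • tmul a b := by
  rw [tmul, ← TensorProduct.smul_tmul', map_smul]; rfl

theorem tmul_smul {m n : ℕ} (c : 𝕜) (a : ⨂[𝕜]^m V) (b : ⨂[𝕜]^n V) :
    tmul a (c • b) = c • tmul a b := by
  rw [tmul, TensorProduct.tmul_smul, map_smul]; rfl

theorem zero_tmul {m n : ℕ} (b : ⨂[𝕜]^n V) : tmul (0 : ⨂[𝕜]^m V) b = 0 := by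
  rw [tmul, TensorProduct.zero_tmul, map_zero]

theorem tmul_zero {m n : ℕ} (a : ⨂[𝕜]^m V) : tmul a (0 : ⨂[𝕜]^n V) = 0 := by
  rw [tmul, TensorProduct.tmul_zero, map_zero]

theorem ins_tmul_left {m n : ℕ} (i : Fin (m - 1)) (v : Fin m → V) (w : Fin n → V)
    (t : V ⊗[𝕜] V) : ins (𝕜 := 𝕜) (n := m + n) ⟨0 + i, by omega⟩ (Fin.append v w) t =
      tmul (ins i v t) (PiTensorProduct.tprod 𝕜 w) := by
  induction t with
  | zero => simp [zero_tmul]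
  | add x y hx hy => rw [map_add, map_add, add_tmul, hx, hy]
  | tmul x y =>
    rw [ins_tmul, ins_tmul, tmul_tprod]
    congr 1
    funext l
    induction l using Fin.addCases with
    | left l => simp [Function.update_apply, Fin.ext_iff]
    | right l =>
      simp only [Function.update_apply, Fin.ext_iff, Fin.append_right, Fin.val_natAdd]
      rw [if_neg (by omega), if_neg (by omega)]

theorem ins_tmul_right {m n : ℕ} (i : Fin (n - 1)) (v : Fin m → V) (w : Fin n → V)
    (t : V ⊗[𝕜] V) : ins (𝕜 := 𝕜) (n := m + n) ⟨m + i, by omega⟩ (Fin.append v w) t =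
      tmul (PiTensorProduct.tprod 𝕜 v) (ins i w t) := by
  induction t with
  | zero => simp [tmul_zero]
  | add x y hx hy => rw [map_add, map_add, tmul_add, hx, hy]
  | tmul x y =>
    rw [ins_tmul, ins_tmul, tmul_tprod]
    congr 1
    funext l
    induction l using Fin.addCases with
    | left l =>
      simp only [Function.update_apply, Fin.ext_iff, Fin.append_left, Fin.val_castAdd]
      rw [if_neg (by omega), if_neg (by omega)]
    | right l => simp [Function.update_apply, Fin.ext_iff, add_assoc]

namespace HeckeSymmetry

variable (H : HeckeSymmetry 𝕜 V)

theorem act_tmul_left {m n : ℕ} (i : Fin (m - 1)) (a : ⨂[𝕜]^m V) (b : ⨂[𝕜]^n V) :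
    H.act (m + n) ⟨0 + i, by omega⟩ (tmul a b) = tmul (H.act m i a) b := by
  induction a using PiTensorProduct.induction_on with
  | add x y hx hy => rw [add_tmul, map_add, map_add, add_tmul, hx, hy]
  | smul_tprod c v =>
    induction b using PiTensorProduct.induction_on with
    | add x y hx hy => rw [tmul_add, map_add, tmul_add, hx, hy]
    | smul_tprod d w =>
      rw [smul_tmul, tmul_smul, map_smul, map_smul, map_smul, smul_tmul, tmul_smul]
      congr 2
      rw [tmul_tprod, act_tprod, act_tprod, ins_tmul_left]
      congr 4
      · exact (congrArg (Fin.append v w) (Fin.ext (by simp))).trans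
          (Fin.append_left v w ⟨i, by omega⟩)
      · exact (congrArg (Fin.append v w) (Fin.ext (by simp))).trans
          (Fin.append_left v w ⟨i + 1, by omega⟩)

theorem act_tmul_right {m n : ℕ} (i : Fin (n - 1)) (a : ⨂[𝕜]^m V) (b : ⨂[𝕜]^n V) :
    H.act (m + n) ⟨m + i, by omega⟩ (tmul a b) = tmul a (H.act n i b) := by
  induction a using PiTensorProduct.induction_on with
  | add x y hx hy => rw [add_tmul, map_add, add_tmul, hx, hy]
  | smul_tprod c v =>
    induction b using PiTensorProduct.induction_on with
    | add x y hx hy => rw [tmul_add, map_add, map_add, tmul_add, hx, hy]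
    | smul_tprod d w =>
      rw [smul_tmul, tmul_smul, map_smul, map_smul, map_smul, smul_tmul, tmul_smul]
      congr 2
      rw [tmul_tprod, act_tprod, act_tprod, ins_tmul_right]
      congr 4
      · exact Fin.append_right v w ⟨i, by omega⟩
      · exact (congrArg (Fin.append v w) (Fin.ext (by simp [add_assoc]))).trans
          (Fin.append_right v w ⟨i + 1, by omega⟩)

theorem rep_tmul_left {m n : ℕ} (h : HeckeAlgebra H.q m) (a : ⨂[𝕜]^m V) (b : ⨂[𝕜]^n V) :
    H.rep (m + n) (HeckeAlgebra.shift H.q 0 (by omega) h) (tmul a b) =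
      tmul (H.rep m h a) b := by
  induction h using HeckeAlgebra.induction_gen generalizing a with
  | hs r => simp [AlgHom.commutes, smul_tmul]
  | hg i => rw [HeckeAlgebra.shift_gen, rep_gen, rep_gen, act_tmul_left]
  | hadd x y hx hy => simp only [map_add, LinearMap.add_apply, add_tmul, hx, hy]
  | hmul x y hx hy => simp only [map_mul, Module.End.mul_apply, hx, hy]

theorem rep_tmul_right {m n : ℕ} (h : HeckeAlgebra H.q n) (a : ⨂[𝕜]^m V) (b : ⨂[𝕜]^n V) :
    H.rep (m + n) (HeckeAlgebra.shift H.q m le_rfl h) (tmul a b) =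
      tmul a (H.rep n h b) := by
  induction h using HeckeAlgebra.induction_gen generalizing b with
  | hs r => simp [AlgHom.commutes, tmul_smul]
  | hg i => rw [HeckeAlgebra.shift_gen, rep_gen, rep_gen, act_tmul_right]
  | hadd x y hx hy => simp only [map_add, LinearMap.add_apply, tmul_add, hx, hy]
  | hmul x y hx hy => simp only [map_mul, Module.End.mul_apply, hx, hy]

/-- The subspace `Υ^{(n)} = ⋂ (T_i - q) V^{⊗ n}` of `V^{⊗ n}`; it is the whole space for
`n = 0, 1`. -/
def upsilon (n : ℕ) : Submodule 𝕜 (⨂[𝕜]^n V) :=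
  ⨅ i : Fin (n - 1), LinearMap.range (H.act n i - H.q • LinearMap.id)

theorem mem_upsilon_iff {n : ℕ} {u : ⨂[𝕜]^n V} :
    u ∈ H.upsilon n ↔ ∀ j, j + 1 < n → u ∈ HeckeAlgebra.imG H.q (H.rep n) j := by
  have e : ∀ j (hj : j + 1 < n), HeckeAlgebra.imG H.q (H.rep n) j =
      LinearMap.range (H.act n ⟨j, by omega⟩ - H.q • LinearMap.id) := by
    intro j hj
    rw [HeckeAlgebra.imG, map_sub, AlgHom.commutes, HeckeAlgebra.g, dif_pos (by omega), rep_gen]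
    rfl
  rw [upsilon, Submodule.mem_iInf]
  constructor
  · intro h j hj
    rw [e j hj]
    exact h _
  · intro h i
    rw [← e i (by omega)]
    exact h i (by omega)

theorem star_mem {m n : ℕ} {a : ⨂[𝕜]^m V} {b : ⨂[𝕜]^n V} (ha : a ∈ H.upsilon m)
    (hb : b ∈ H.upsilon n) :
    H.rep (m + n) (HeckeAlgebra.shuffleAntisymmetrizer H.q (m + n) m) (tmul a b) ∈
      H.upsilon (m + n) := by
  rw [mem_upsilon_iff] at ha hb ⊢
  have e : HeckeAlgebra.shuffleAntisymmetrizer H.q (m + n) m =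
      HeckeAlgebra.Ys H.q (m + n) 0 (m + n) m := by
    rw [HeckeAlgebra.Ys_eq]
  rw [e]
  refine HeckeAlgebra.Ys_mem_imG H.q (H.rep (m + n)) (m + n) m le_rfl (by omega) _ ?_
  intro j hj hjm
  rcases Nat.lt_or_ge (j + 1) m with h | h
  · obtain ⟨w, rfl⟩ := ha j h
    refine ⟨tmul w b, ?_⟩
    rw [← rep_tmul_left, map_sub (HeckeAlgebra.shift _ _ _), AlgHom.commutes,
      HeckeAlgebra.shift_g _ _ _ _ h, zero_add]
  · obtain ⟨i, rfl⟩ : ∃ i, j = m + i := ⟨j - m, by omega⟩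
    obtain ⟨w, rfl⟩ := hb i (by omega)
    refine ⟨tmul a w, ?_⟩
    rw [← rep_tmul_right, map_sub (HeckeAlgebra.shift _ _ _), AlgHom.commutes,
      HeckeAlgebra.shift_g _ _ _ _ (by omega)]

/-- The multiplication `a ⋆ b = y_{m+n/m,n}(ab)` on the subspaces `Υ^{(n)}`. -/
def star {m n : ℕ} (a : H.upsilon m) (b : H.upsilon n) : H.upsilon (m + n) :=
  ⟨H.rep (m + n) (HeckeAlgebra.shuffleAntisymmetrizer H.q (m + n) m) (tmul a.1 b.1),
    H.star_mem a.2 b.2⟩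

/-- The unit element in `Υ^{(0)}`. -/
def one : H.upsilon 0 :=
  ⟨PiTensorProduct.tprod 𝕜 Fin.elim0, by
    rw [upsilon, Submodule.mem_iInf]; intro i; exact i.elim0⟩

theorem mk_eq_of_cast {m n : ℕ} (h : m = n) {a : H.upsilon m} {b : H.upsilon n}
    (hab : TensorPower.cast 𝕜 V h a.1 = b.1) :
    GradedMonoid.mk (A := fun i => H.upsilon i) m a = GradedMonoid.mk n b := by
  subst h
  rw [TensorPower.cast_refl] at hab
  rw [Subtype.ext hab]

theorem cast_rep_Ys {m n : ℕ} (h : m = n) (s p r : ℕ) (a : ⨂[𝕜]^m V) :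
    TensorPower.cast 𝕜 V h (H.rep m (HeckeAlgebra.Ys H.q m s p r) a) =
      H.rep n (HeckeAlgebra.Ys H.q n s p r) (TensorPower.cast 𝕜 V h a) := by
  subst h
  simp

theorem one_star {n : ℕ} (a : H.upsilon n) :
    GradedMonoid.mk (A := fun i => H.upsilon i) (0 + n) (H.star H.one a) = ⟨n, a⟩ := by
  refine H.mk_eq_of_cast (zero_add n) ?_
  simp only [star, HeckeAlgebra.shuffleAntisymmetrizer_zero, map_one, Module.End.one_apply]
  exact TensorPower.one_mul a.1

theorem star_one {n : ℕ} (a : H.upsilon n) :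
    GradedMonoid.mk (A := fun i => H.upsilon i) (n + 0) (H.star a H.one) = ⟨n, a⟩ := by
  refine H.mk_eq_of_cast (add_zero n) ?_
  have : HeckeAlgebra.shuffleAntisymmetrizer H.q (n + 0) n = 1 :=
    HeckeAlgebra.shuffleAntisymmetrizer_self H.q n
  simp only [star, this, map_one, Module.End.one_apply]
  exact TensorPower.mul_one a.1

theorem star_assoc {m n p : ℕ} (a : H.upsilon m) (b : H.upsilon n) (c : H.upsilon p) :
    GradedMonoid.mk (A := fun i => H.upsilon i) (m + n + p) (H.star (H.star a b) c) =
      ⟨m + (n + p), H.star a (H.star b c)⟩ := by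
  refine H.mk_eq_of_cast (add_assoc m n p) ?_
  simp only [star]
  rw [← rep_tmul_left, ← rep_tmul_right, ← Module.End.mul_apply, ← map_mul,
    ← Module.End.mul_apply, ← map_mul]
  have e1 : HeckeAlgebra.shuffleAntisymmetrizer H.q (m + n + p) (m + n) *
      HeckeAlgebra.shift H.q 0 (by omega) (HeckeAlgebra.shuffleAntisymmetrizer H.q (m + n) m) =
      HeckeAlgebra.Ys H.q (m + n + p) 0 (m + n + p) m *
        HeckeAlgebra.Ys H.q (m + n + p) m (n + p) n := by
    rw [← HeckeAlgebra.Ys_assoc H.q _ m n p le_rfl, HeckeAlgebra.Ys_eq]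
    congr 1
    rw [HeckeAlgebra.Ys, dif_pos]
  have e2 : HeckeAlgebra.shuffleAntisymmetrizer H.q (m + (n + p)) m *
      HeckeAlgebra.shift H.q m le_rfl (HeckeAlgebra.shuffleAntisymmetrizer H.q (n + p) n) =
      HeckeAlgebra.Ys H.q (m + (n + p)) 0 (m + n + p) m *
        HeckeAlgebra.Ys H.q (m + (n + p)) m (n + p) n := by
    rw [add_assoc m n p, HeckeAlgebra.Ys_eq]
    congr 1
    rw [HeckeAlgebra.Ys, dif_pos]
  rw [e1, e2, map_mul, map_mul, Module.End.mul_apply, Module.End.mul_apply, cast_rep_Ys,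
    cast_rep_Ys]
  congr 2
  exact TensorPower.mul_assoc a.1 b.1 c.1

theorem star_zero {m n : ℕ} (a : H.upsilon m) : H.star a (0 : H.upsilon n) = 0 :=
  Subtype.ext (by simp [star, tmul_zero])

theorem zero_star {m n : ℕ} (b : H.upsilon n) : H.star (0 : H.upsilon m) b = 0 :=
  Subtype.ext (by simp [star, zero_tmul])

theorem star_add {m n : ℕ} (a : H.upsilon m) (b c : H.upsilon n) :
    H.star a (b + c) = H.star a b + H.star a c :=
  Subtype.ext (by simp [star, tmul_add])

theorem add_star {m n : ℕ} (a b : H.upsilon m) (c : H.upsilon n) :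
    H.star (a + b) c = H.star a c + H.star b c :=
  Subtype.ext (by simp [star, add_tmul])

instance : GradedMonoid.GOne fun n => H.upsilon n where
  one := H.one

instance : GradedMonoid.GMul fun n => H.upsilon n where
  mul := H.star

instance : GradedMonoid.GMonoid fun n => H.upsilon n where
  one_mul x := H.one_star x.2
  mul_one x := H.star_one x.2
  mul_assoc x y z := H.star_assoc x.2 y.2 z.2

instance : DirectSum.GSemiring fun n => H.upsilon n where
  mul_zero := H.star_zero
  zero_mul := H.zero_star
  mul_add := H.star_add
  add_mul := H.add_star
  natCast n := n • H.one
  natCast_zero := zero_smul _ _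
  natCast_succ n := by rw [add_smul, one_smul]; rfl

instance : DirectSum.GRing fun n => H.upsilon n where
  intCast n := n • H.one
  intCast_ofNat _ := natCast_zsmul _ _
  intCast_negSucc_ofNat _ := negSucc_zsmul _ _

theorem smul_one_star {n : ℕ} (r : 𝕜) (a : H.upsilon n) :
    GradedMonoid.mk (A := fun i => H.upsilon i) (0 + n) (H.star (r • H.one) a) = ⟨n, r • a⟩ := by
  refine H.mk_eq_of_cast (zero_add n) ?_
  simp only [star, HeckeAlgebra.shuffleAntisymmetrizer_zero, map_one, Module.End.one_apply,
    Submodule.coe_smul, smul_tmul, map_smul]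
  exact congrArg (r • ·) (TensorPower.one_mul a.1)

theorem star_smul_one {n : ℕ} (r : 𝕜) (a : H.upsilon n) :
    GradedMonoid.mk (A := fun i => H.upsilon i) (n + 0) (H.star a (r • H.one)) = ⟨n, r • a⟩ := by
  refine H.mk_eq_of_cast (add_zero n) ?_
  have : HeckeAlgebra.shuffleAntisymmetrizer H.q (n + 0) n = 1 :=
    HeckeAlgebra.shuffleAntisymmetrizer_self H.q n
  simp only [star, this, map_one, Module.End.one_apply,
    Submodule.coe_smul, tmul_smul, map_smul]
  exact congrArg (r • ·) (TensorPower.mul_one a.1)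

instance : DirectSum.GAlgebra 𝕜 fun n => H.upsilon n where
  toFun := (LinearMap.toSpanSingleton 𝕜 _ H.one).toAddMonoidHom
  map_one := show (1 : 𝕜) • H.one = H.one from one_smul _ _
  map_mul r s := by
    refine ((H.smul_one_star r (s • H.one)).trans ?_).symm
    rw [smul_smul]; rfl
  commutes r x := (H.smul_one_star r x.2).trans (H.star_smul_one r x.2).symm
  smul_def r x := (H.smul_one_star r x.2).symm

/-- The graded algebra `Υ(V, R) = ⨁ Υ^{(n)}` with the multiplication `⋆`. -/
abbrev UpsilonAlgebra := ⨁ n, H.upsilon n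

variable (𝕜 V) in
/-- The embedding of `V ⊗ V` in the tensor algebra. -/
def tensorTwo : V ⊗[𝕜] V →ₗ[𝕜] TensorAlgebra 𝕜 V :=
  TensorProduct.lift ((LinearMap.mul 𝕜 (TensorAlgebra 𝕜 V)).compl₁₂
    (TensorAlgebra.ι 𝕜) (TensorAlgebra.ι 𝕜))

/-- The relations `t = 0` for `t ∈ Ker (R - q) ⊆ V ⊗ V`. -/
def lambdaRel (x y : TensorAlgebra 𝕜 V) : Prop :=
  (∃ t ∈ LinearMap.ker (H.R - H.q • LinearMap.id), x = tensorTwo 𝕜 V t) ∧ y = 0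

/-- The `R`-skewsymmetric algebra `Λ(V, R)`, the factor algebra of the tensor algebra by the ideal
generated by `Ker (R - q)`. -/
abbrev LambdaAlgebra := RingQuot H.lambdaRel

/-- The homogeneous component of degree `n` of `Λ(V, R)`. -/
def lambda (n : ℕ) : Submodule 𝕜 H.LambdaAlgebra :=
  (LinearMap.range (TensorAlgebra.ι 𝕜 (M := V)) ^ n).map
    (RingQuot.mkAlgHom 𝕜 H.lambdaRel).toLinearMap

end HeckeSymmetry
end

end

end HeckeSym

namespace HeckeSym

noncomputable section

/-! The central identity is y_{m+l}(a ⊗ b) = (y_m a) ⋆ (y_l b), which reflects the unique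
factorisation of a permutation as a shuffle times an element of a Young subgroup
(`HeckeAlgebra.As_add`, `rep_antisymmetrizer_add`). Since y_0 = y_1 = 1, it shows that the
subalgebra of Υ generated by V is the sum of the images Im y_m. So (ii) means Υ^(m) = Im y_m for all
m, and (ii) ⇒ (i) follows because Υ^(n) ≠ 0.

For (i) ⇒ (ii), let ω span Υ^(n). As 0 ≠ Im y_n ⊆ Υ^(n), also ω ∈ Im y_n. Contracting the last
factors sends Υ^(m+l) into Υ^(m), so Υ^(m) = 0 for m > n. Take 1 ≤ k ≤ n and h ∈ Υ^(k), and assume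
Υ^(i) = Im y_i for i < k. Then h ⋆ ω = 0. A Mackey type decomposition writes the operator
y_{k+n/k,n} as the scalar q^{kn} plus terms y_{k/i,k-i} · x · β with i < k, where x involves only
positions beyond the first k and β exchanges two adjacent blocks of length k-i
(`HeckeAlgebra.Ys_mem_mackeySpan`). By induction and contraction h ∈ Im(y_i ⊗ Id), hence h ⊗ ω ∈
Im(y_i ⊗ Id ⊗ y_n). Up to an invertible factor acting beyond the first k positions, β carries y_n to
the positions following the first i; there y_n has y_{k-i} as a left factor, and y_{k/i,k-i}(y_i ⊗
y_{k-i}) = y_k. Hence each term sends h ⊗ ω into Im(y_k ⊗ Id) (`HeckeAlgebra.mem_range_As`). As q ≠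
0, also h ⊗ ω ∈ Im(y_k ⊗ Id), and a contraction removing ω gives h ∈ Im y_k (`upsilon_eq_range`).

For (ii) ⇒ (iii′): on V ⊗ V the product ⋆ is q - R, so the map from the tensor algebra to Υ kills
Ker(R - q) and factors through Λ. For (iii) ⇒ (ii), where the isomorphism need not be graded, a
dimension count is made in the space of indecomposables: the images of V span it, while it contains
a copy of Υ^(1) ≅ V, so nothing is left in degrees above 1
(`degOneSubalgebra_eq_top_of_surjective`). -/

theorem extLast_inv {n : ℕ} (σ : Equiv.Perm (Fin n)) : (extLast σ)⁻¹ = extLast σ⁻¹ := by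
  rw [inv_eq_iff_mul_eq_one, ← extLast_mul, mul_inv_cancel, extLast_one]

namespace HeckeAlgebra

variable {𝕜 : Type*} [Field 𝕜] (q : 𝕜)

/-! ### Recursion for the antisymmetrizers -/

/-- Coset decomposition for the stabiliser of the last point: k is the position that the permutation
sends to the last point, and (n+1) · n! = (n+1)! makes injectivity sufficient. -/
theorem extLast_mul_cyc_bijective (n : ℕ) : Function.Bijective
    fun p : Fin (n + 1) × Equiv.Perm (Fin n) => extLast p.2 * cyc (n + 1) p.1 (n - p.1) := by
  rw [Fintype.bijective_iff_injective_and_card]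
  constructor
  · rintro ⟨k, σ⟩ ⟨l, π⟩ h
    -- The parameter `0 : ℚ` is a dummy, as only the combinatorial part of `cyc_spec` is used. The
    -- two products take the value n at k and at l respectively.
    have hk := (cyc_spec (0 : ℚ) σ (n - k) k (by omega)).1 k
    have hl := (cyc_spec (0 : ℚ) π (n - l) l (by omega)).1 l
    simp only at h
    rw [dif_neg (lt_irrefl _), dif_pos rfl] at hk hl
    rw [h] at hk
    obtain rfl : k = l := (extLast π * cyc (n + 1) l (n - l)).injective (Fin.ext (hk.trans hl.symm))
    rw [extLast_injective (mul_right_cancel h)]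
  · simp [Fintype.card_perm, Nat.factorial_succ]

theorem sum_perm_succ {M : Type*} [AddCommMonoid M] (n : ℕ) (f : Equiv.Perm (Fin (n + 1)) → M) :
    ∑ π, f π = ∑ k ∈ Finset.range (n + 1), ∑ σ : Equiv.Perm (Fin n),
      f (extLast σ * cyc (n + 1) k (n - k)) := by
  rw [← (extLast_mul_cyc_bijective n).sum_comp f, Fintype.sum_prod_type, Finset.sum_range]

/-- Needed because the exponents of q in y_n are truncated differences of natural numbers. -/
theorem len_le {n : ℕ} (π : Equiv.Perm (Fin n)) : len π ≤ n * (n - 1) / 2 := by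
  induction n with
  | zero => simp [Subsingleton.elim π 1, len_one]
  | succ n ih =>
    obtain ⟨⟨k, σ⟩, rfl⟩ := (extLast_mul_cyc_bijective n).2 π
    have := ih σ
    simp only
    rw [(cyc_spec (0 : ℚ) σ (n - k) k (by omega)).2.1, Nat.triangle_succ]
    omega

/-- `T_a T_{a+1} ⋯ T_{a+m-1}` -/
def ascT (n : ℕ) : ℕ → ℕ → HeckeAlgebra q n
  | _, 0 => 1
  | a, m + 1 => g q n a * ascT n (a + 1) m

theorem ascT_succ' (N a m : ℕ) : ascT q N a (m + 1) = ascT q N a m * g q N (a + m) := by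
  induction m generalizing a with
  | zero => simp [ascT]
  | succ m ih =>
    rw [ascT, ih, ascT, mul_assoc, add_right_comm, add_assoc]

theorem shift_ascT {n N : ℕ} (s : ℕ) (h : s + n ≤ N) (a m : ℕ) (ham : a + m < n) :
    shift q s h (ascT q n a m) = ascT q N (s + a) m := by
  induction m generalizing a with
  | zero => simp [ascT]
  | succ m ih =>
    rw [ascT, map_mul, ih (a + 1) (by omega), shift_g q s h a (by omega), ascT, add_assoc]

theorem len_cyc (n m a : ℕ) (ha : a + m = n) : len (cyc (n + 1) a m) = m := by
  have := (cyc_spec (0 : ℚ) (1 : Equiv.Perm (Fin n)) m a ha).2.1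
  rwa [extLast_one, one_mul, len_one, zero_add] at this

/-- Inversion reverses a reduced word, so descending products become ascending ones. -/
theorem T_cyc_inv (n m a : ℕ) (ha : a + m = n) :
    T q (cyc (n + 1) a m)⁻¹ = ascT q (n + 1) a m := by
  induction m generalizing a with
  | zero => simp [cyc, ascT, T_one]
  | succ m ih =>
    have h1 : cyc (n + 1) a (m + 1) = cyc (n + 1) (a + 1) m * tau (n := n + 1) ⟨a, by omega⟩ := by
      rw [cyc, dif_pos]
    have h2 := len_cyc n m (a + 1) (by omega)
    have h3 := len_cyc n (m + 1) a ha
    have h4 : (cyc (n + 1) a (m + 1))⁻¹ =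
        tau (n := n + 1) ⟨a, by omega⟩ * (cyc (n + 1) (a + 1) m)⁻¹ := by
      rw [h1, mul_inv_rev, tau_inv]
    rw [h4, T_mul, T_tau, ih _ (by omega), ascT, g, dif_pos]
    rw [← h4, len_inv, h3, len_inv, h2, len_tau, add_comm]

theorem antisymmetrizer_coeff {n k l : ℕ} (hk : k ≤ n) (hl : l ≤ n * (n - 1) / 2) :
    (-1 : 𝕜) ^ (l + (n - k)) * q ^ ((n + 1) * (n + 1 - 1) / 2 - (l + (n - k))) =
      ((-1) ^ (n - k) * q ^ k) * ((-1) ^ l * q ^ (n * (n - 1) / 2 - l)) := by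
  have : (n + 1) * (n + 1 - 1) / 2 - (l + (n - k)) = k + (n * (n - 1) / 2 - l) := by
    rw [Nat.triangle_succ]; omega
  rw [this, pow_add, pow_add]
  ring

/-- Lengths add in the coset factorisation, so each T of a product splits. This version, with y_n on
the left, serves to compare images of antisymmetrizers; the one with y_n on the right serves to
relate them to ⋆. -/
theorem antisymmetrizer_succ_right (n : ℕ) : antisymmetrizer q (n + 1) =
    shift q 0 (by omega) (antisymmetrizer q n) *
      ∑ k ∈ Finset.range (n + 1), ((-1) ^ (n - k) * q ^ k) • descT q (n + 1) k (n - k) := by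
  rw [antisymmetrizer, sum_perm_succ, Finset.mul_sum]
  refine Finset.sum_congr rfl fun k hk => ?_
  have hk : k ≤ n := Nat.lt_succ_iff.1 (Finset.mem_range.1 hk)
  rw [antisymmetrizer, map_sum, Finset.sum_mul]
  refine Finset.sum_congr rfl fun σ _ => ?_
  obtain ⟨-, h2, h3⟩ := cyc_spec q σ (n - k) k (by omega)
  rw [h2, h3, T_extLast, map_smul, smul_mul_smul_comm, antisymmetrizer_coeff q hk (len_le σ),
    mul_comm ((-1) ^ (n - k) * q ^ k)]

/-- The mirror image of the previous factorisation: the sum is reindexed by π ↦ π⁻¹, which preserves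
length. -/
theorem antisymmetrizer_succ_left (n : ℕ) : antisymmetrizer q (n + 1) =
    (∑ k ∈ Finset.range (n + 1), ((-1) ^ (n - k) * q ^ k) • ascT q (n + 1) k (n - k)) *
      shift q 0 (by omega) (antisymmetrizer q n) := by
  rw [antisymmetrizer, ← Equiv.sum_comp (Equiv.inv _), sum_perm_succ, Finset.sum_mul]
  refine Finset.sum_congr rfl fun k hk => ?_
  have hk : k ≤ n := Nat.lt_succ_iff.1 (Finset.mem_range.1 hk)
  rw [antisymmetrizer, map_sum, Finset.mul_sum, ← Equiv.sum_comp (Equiv.inv _)]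
  refine Finset.sum_congr rfl fun σ _ => ?_
  have h2 := (cyc_spec (0 : ℚ) σ⁻¹ (n - k) k (by omega)).2.1
  simp only [Equiv.inv_apply]
  have h3 : T q (extLast σ⁻¹ * cyc (n + 1) k (n - k))⁻¹ =
      ascT q (n + 1) k (n - k) * shift q 0 (by omega) (T q σ) := by
    rw [mul_inv_rev, T_mul, T_cyc_inv q n _ _ (by omega), extLast_inv, inv_inv, T_extLast]
    rw [← mul_inv_rev, len_inv, h2, len_inv, len_inv, len_cyc n _ _ (by omega), len_inv,
      len_extLast, len_inv, add_comm]
  rw [h3, len_inv, h2, map_smul, smul_mul_smul_comm, len_inv,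
    antisymmetrizer_coeff q hk (len_le σ)]

/-- A permutation increasing on all positions but the last is determined by the value k at the last
position; its reduced word is the ascending one starting at k. -/
theorem shuffleAntisymmetrizer_succ_self (n : ℕ) : shuffleAntisymmetrizer q (n + 1) n =
    ∑ k ∈ Finset.range (n + 1), ((-1) ^ (n - k) * q ^ k) • ascT q (n + 1) k (n - k) := by
  induction n with
  | zero => simp [shuffleAntisymmetrizer_zero, ascT]
  | succ n ih =>
    rw [shuffleAntisymmetrizer_succ q (n + 1) n (by omega), ih, shuffleAntisymmetrizer_self,
      map_one, Finset.sum_range_succ _ (n + 1), map_sum, Finset.sum_mul, Finset.smul_sum]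
    refine (add_comm _ _).trans ?_
    congr 1
    · refine Finset.sum_congr rfl fun k hk => ?_
      have hk : k ≤ n := Nat.lt_succ_iff.1 (Finset.mem_range.1 hk)
      rw [map_smul, shift_ascT q 0 _ _ _ (by omega), smul_mul_assoc, smul_smul,
        show n + 1 - k = n - k + 1 by omega, ascT_succ', show n + 1 - n = 0 + 1 by omega, descT,
        descT, one_mul, zero_add, pow_one, pow_succ, show k + (n - k) = n by omega,
        zero_add]
      congr 1
      ring
    · simp [ascT]

theorem antisymmetrizer_succ (n : ℕ) : antisymmetrizer q (n + 1) =
    shuffleAntisymmetrizer q (n + 1) n * shift q 0 (by omega) (antisymmetrizer q n) := by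
  rw [antisymmetrizer_succ_left, shuffleAntisymmetrizer_succ_self]

theorem antisymmetrizer_zero : antisymmetrizer q 0 = 1 := by
  simp [antisymmetrizer, Subsingleton.elim (default : Equiv.Perm (Fin 0)) 1, len_one, T_one]

theorem antisymmetrizer_one : antisymmetrizer q 1 = 1 := by
  rw [antisymmetrizer_succ, antisymmetrizer_zero, shuffleAntisymmetrizer_zero, map_one, one_mul]

/-- The antisymmetrizer `y_n` shifted by `s` steps inside the algebra of rank `N`. -/
def As (N s n : ℕ) : HeckeAlgebra q N :=
  if h : s + n ≤ N then shift q s h (antisymmetrizer q n) else 1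

theorem As_eq {N s n : ℕ} (h : s + n ≤ N) : As q N s n = shift q s h (antisymmetrizer q n) :=
  dif_pos h

theorem As_succ (N s n : ℕ) (h : s + (n + 1) ≤ N) :
    As q N s (n + 1) = Ys q N s (n + 1) n * As q N s n := by
  rw [As_eq q h, As_eq q (by omega), Ys, dif_pos h, antisymmetrizer_succ, map_mul, shift_shift]
  rfl

/-- Gives the inclusion of Im y_{n+m} in Im(y_n ⊗ Id). -/
theorem As_add_right (N s n m : ℕ) (h : s + (n + m) ≤ N) :
    ∃ x, As q N s (n + m) = As q N s n * x := by
  induction m with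
  | zero => exact ⟨1, by simp⟩
  | succ m ih =>
    obtain ⟨x, hx⟩ := ih (by omega)
    refine ⟨x * shift q s (n := n + m + 1) (by omega) (∑ k ∈ Finset.range (n + m + 1),
      ((-1) ^ (n + m - k) * q ^ k) • descT q (n + m + 1) k (n + m - k)), ?_⟩
    rw [← mul_assoc, ← hx]
    change As q N s (n + m + 1) = _
    rw [As_eq q (by omega), antisymmetrizer_succ_right, map_mul, shift_shift,
      As_eq q (by omega)]
    rfl

/-! ### Commuting parabolic subalgebras -/

/-- The subalgebra generated by the `T_i` with `i ≥ p`. -/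
def upper (N p : ℕ) : Subalgebra 𝕜 (HeckeAlgebra q N) :=
  Algebra.adjoin 𝕜 {x | ∃ i, p ≤ i ∧ x = g q N i}

theorem g_mem_upper {N p i : ℕ} (h : p ≤ i) : g q N i ∈ upper q N p :=
  Algebra.subset_adjoin ⟨i, h, rfl⟩

theorem descT_mem_upper {N p a : ℕ} (h : p ≤ a) (m : ℕ) : descT q N a m ∈ upper q N p := by
  induction m generalizing a with
  | zero => exact one_mem _
  | succ m ih => exact mul_mem (ih (by omega)) (g_mem_upper q h)

theorem shift_mem_upper {n N p s : ℕ} (h : s + n ≤ N) (hp : p ≤ s) (x : HeckeAlgebra q n) :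
    shift q s h x ∈ upper q N p := by
  induction x using induction_gen with
  | hs r => rw [AlgHom.commutes]; exact Subalgebra.algebraMap_mem _ _
  | hg i =>
    have := g_mem_upper q (N := N) (p := p) (i := s + i) (by omega)
    rw [g, dif_pos (by omega)] at this
    rw [shift_gen]
    exact this
  | hadd x y hx hy => rw [map_add]; exact add_mem hx hy
  | hmul x y hx hy => rw [map_mul]; exact mul_mem hx hy

/-- Generators acting on disjoint pairs of positions commute; with positions numbered from 0, the
left factor involves only positions ≥ p and the right one only positions < n ≤ p. -/
theorem upper_comm_shift {n N p : ℕ} (h : 0 + n ≤ N) (hp : n ≤ p) {x : HeckeAlgebra q N}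
    (hx : x ∈ upper q N p) (y : HeckeAlgebra q n) :
    x * shift q 0 h y = shift q 0 h y * x := by
  induction hx using Algebra.adjoin_induction with
  | mem x hx =>
    obtain ⟨i, hi, rfl⟩ := hx
    simpa [descT] using descT_comm_shift q 0 i 1 h (by omega) y
  | algebraMap r => exact Algebra.commutes _ _
  | add a b _ _ ha hb => rw [add_mul, mul_add, ha, hb]
  | mul a b _ _ ha hb => rw [mul_assoc, hb, ← mul_assoc, ha, mul_assoc]

theorem upper_comm_Ys {n N p k : ℕ} (hp : n ≤ p) {x : HeckeAlgebra q N}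
    (hx : x ∈ upper q N p) : x * Ys q N 0 n k = Ys q N 0 n k * x := by
  unfold Ys
  split_ifs with h
  · exact upper_comm_shift q h hp hx _
  · simp

theorem upper_comm_As {n N p : ℕ} (hp : n ≤ p) {x : HeckeAlgebra q N}
    (hx : x ∈ upper q N p) : x * As q N 0 n = As q N 0 n * x := by
  unfold As
  split_ifs with h
  · exact upper_comm_shift q h hp hx _
  · simp

theorem Ys_mem_upper {N p s n k : ℕ} (hp : p ≤ s) : Ys q N s n k ∈ upper q N p := by
  unfold Ys
  split_ifs with h
  · exact shift_mem_upper q h hp _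
  · exact one_mem _

theorem As_zero (N s : ℕ) : As q N s 0 = 1 := by simp [As, antisymmetrizer_zero]

/-- The operator form of y_{a+b} = y_{a+b/a,b}(y_a ⊗ y_b). Peeling off the last position reduces the
step in b to the associativity relation for partial antisymmetrizers, with block sizes a, b, 1. -/
theorem As_add (N a b : ℕ) (h : a + b ≤ N) :
    As q N 0 (a + b) = Ys q N 0 (a + b) a * (As q N 0 a * As q N a b) := by
  induction b with
  | zero => simp [As_zero, Ys_self]
  | succ b ih =>
    have e := Ys_assoc q N a b 1 (by omega)
    rw [← add_assoc, As_succ q N 0 (a + b) (by omega), ih (by omega), ← mul_assoc, e, mul_assoc,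
      ← mul_assoc (Ys q N a (b + 1) b), upper_comm_As q le_rfl (Ys_mem_upper q le_rfl), mul_assoc,
      ← As_succ q N a b (by omega)]

/-! ### Block braids -/

/-- The basis element of the permutation that exchanges the block of length `a` starting at
position `i` with the next block of length `b`. -/
def block (N i : ℕ) : ℕ → ℕ → HeckeAlgebra q N
  | 0, _ => 1
  | a + 1, b => block N i a b * descT q N (i + a) b

theorem block_mem_upper {N p i : ℕ} (h : p ≤ i) (a b : ℕ) : block q N i a b ∈ upper q N p := by
  induction a with
  | zero => exact one_mem _
  | succ a ih => exact mul_mem ih (descT_mem_upper q (by omega) _)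

theorem descT_comm_descT {N a m a' m' : ℕ} (h : a + m < a') :
    descT q N a m * descT q N a' m' = descT q N a' m' * descT q N a m := by
  induction m with
  | zero => simp [descT]
  | succ m ih =>
    rw [descT_succ', mul_assoc, ih (by omega), ← mul_assoc, ← mul_assoc,
      ← descT_comm_lt q N a' m' (a + m) (by omega)]

theorem block_comm_descT {N i a b a' m' : ℕ} (h : i + a + b ≤ a') :
    block q N i a b * descT q N a' m' = descT q N a' m' * block q N i a b := by
  induction a with
  | zero => simp [block]
  | succ a ih =>
    rw [block, mul_assoc, descT_comm_descT q (by omega), ← mul_assoc, ih (by omega), mul_assoc]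

/-- Moving a block past b + c positions means moving it past b and then past c. -/
theorem block_add (N i a b c : ℕ) :
    block q N i a (b + c) = block q N (i + b) a c * block q N i a b := by
  induction a with
  | zero => simp [block]
  | succ a ih =>
    rw [block, ih, block, block, descT_add, mul_assoc, ← mul_assoc (block q N i a b),
      block_comm_descT q (a' := i + a + b) le_rfl, add_right_comm i b a]
    simp only [mul_assoc]

/-- The block braid carries operators on the right block of length n to the same operators a places
further left. -/
theorem block_mul_shift {n N : ℕ} (i a : ℕ) (h : i + a + n ≤ N) (x : HeckeAlgebra q n) :
    block q N i a n * shift q (i + a) h x = shift q i (by omega) x * block q N i a n := by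
  induction a with
  | zero => simp [block]
  | succ a ih =>
    have := descT_mul_shift q (i + a) (by omega) x (N := N)
    simp only [← add_assoc]
    rw [block, mul_assoc, this, ← mul_assoc, ih (by omega), mul_assoc]

theorem block_mul_As (N i a n : ℕ) (h : i + a + n ≤ N) :
    block q N i a n * As q N (i + a) n = As q N i n * block q N i a n := by
  rw [As_eq q h, As_eq q (by omega), block_mul_shift]

/-- The quadratic relation reads (T + 1 - q)T = q. The inverse is kept inside the subalgebra so that
it still commutes with everything acting on the first p positions; out of range `g` has the default
value 1. -/
theorem exists_g_inv (hq : q ≠ 0) {N p i : ℕ} (h : p ≤ i) :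
    ∃ y ∈ upper q N p, y * g q N i = 1 := by
  by_cases hi : i < N - 1
  · have e := gen_quad q (n := N) ⟨i, hi⟩
    refine ⟨algebraMap 𝕜 _ q⁻¹ * (g q N i + 1 - algebraMap 𝕜 _ q),
      mul_mem (Subalgebra.algebraMap_mem _ _) (sub_mem (add_mem (g_mem_upper q h) (one_mem _))
        (Subalgebra.algebraMap_mem _ _)), ?_⟩
    have e' : (g q N i + 1 - algebraMap 𝕜 _ q) * g q N i = algebraMap 𝕜 _ q := by
      rw [g, dif_pos hi]
      have : (gen q (⟨i, hi⟩ : Fin (N - 1)) + 1 - algebraMap 𝕜 _ q) * gen q ⟨i, hi⟩ =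
          (gen q ⟨i, hi⟩ - algebraMap 𝕜 _ q) * (gen q ⟨i, hi⟩ + 1) + algebraMap 𝕜 _ q := by
        noncomm_ring
      rw [this, e, zero_add]
    rw [mul_assoc, e', ← map_mul, inv_mul_cancel₀ hq, map_one]
  · exact ⟨1, one_mem _, by rw [g, dif_neg hi, one_mul]⟩

theorem exists_descT_inv (hq : q ≠ 0) {N p a : ℕ} (h : p ≤ a) (m : ℕ) :
    ∃ y ∈ upper q N p, y * descT q N a m = 1 := by
  induction m generalizing a with
  | zero => exact ⟨1, one_mem _, by simp [descT]⟩
  | succ m ih =>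
    obtain ⟨y, hy, hy'⟩ := ih (a := a + 1) (by omega)
    obtain ⟨z, hz, hz'⟩ := exists_g_inv q hq (N := N) h
    exact ⟨z * y, mul_mem hz hy, by
      rw [descT, mul_assoc, ← mul_assoc y, hy', one_mul, hz']⟩

theorem exists_block_inv (hq : q ≠ 0) {N p i : ℕ} (h : p ≤ i) (a b : ℕ) :
    ∃ y ∈ upper q N p, y * block q N i a b = 1 := by
  induction a with
  | zero => exact ⟨1, one_mem _, by simp [block]⟩
  | succ a ih =>
    obtain ⟨y, hy, hy'⟩ := ih
    obtain ⟨z, hz, hz'⟩ := exists_descT_inv q hq (N := N) (a := i + a) (p := p) (by omega) b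
    exact ⟨z * y, mul_mem hz hy, by
      rw [block, mul_assoc, ← mul_assoc y, hy', one_mul, hz']⟩

/-! ### A Mackey type decomposition -/

/-- The span of the terms of the Mackey decomposition of `y_{M/k,M-k}` with respect to the first
`p` positions in which less than `p` of these positions come from the first block. -/
def mackeySpan (N p M k : ℕ) : Submodule 𝕜 (HeckeAlgebra q N) :=
  Submodule.span 𝕜 {z | ∃ i, ∃ x ∈ upper q N p, i < p ∧ i ≤ k ∧ p + k ≤ M + i ∧
    z = Ys q N 0 p i * x * block q N i (k - i) (p - i)}

theorem mackeySpan_succ (N p M k : ℕ) : mackeySpan q N p M k ≤ mackeySpan q N p (M + 1) k := by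
  refine Submodule.span_mono ?_
  rintro z ⟨i, x, hx, h1, h2, h3, rfl⟩
  exact ⟨i, x, hx, h1, h2, by omega, rfl⟩

/-- The descending product splits at the end of the second exchanged block: the part beyond it is
absorbed into the middle factor, and the rest adds one more strand to the block braid. -/
theorem mul_descT_mem_mackeySpan {N p M k : ℕ} {z : HeckeAlgebra q N}
    (hz : z ∈ mackeySpan q N p M k) :
    z * descT q N k (M - k) ∈ mackeySpan q N p (M + 1) (k + 1) := by
  induction hz using Submodule.span_induction with
  | zero => rw [zero_mul]; exact zero_mem _
  | add a b _ _ ha hb => rw [add_mul]; exact add_mem ha hb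
  | smul c a _ ha => rw [smul_mul_assoc]; exact Submodule.smul_mem _ _ ha
  | mem z hz =>
    obtain ⟨i, x, hx, h1, h2, h3, rfl⟩ := hz
    refine Submodule.subset_span ⟨i, x * descT q N (k + (p - i)) (M - k - (p - i)),
      mul_mem hx (descT_mem_upper q (by omega) _), h1, by omega, by omega, ?_⟩
    have e : M - k = (p - i) + (M - k - (p - i)) := by omega
    have e' : descT q N k (M - k) =
        descT q N (k + (p - i)) (M - k - (p - i)) * descT q N k (p - i) := by
      rw [← descT_add, ← e]
    rw [e', show k + 1 - i = k - i + 1 by omega, block, show i + (k - i) = k by omega, mul_assoc,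
      ← mul_assoc (block _ _ _ _ _), block_comm_descT q (by omega)]
    simp only [mul_assoc]

/-- Shuffles d are sorted by the number i of values below p taken on the first k positions. For k <
p always i < p; for k = p the value i = p occurs only for d = 1, which contributes the scalar. Both
claims are proved together by induction on M, since the recursion for `Ys` relates k + 1 to k. -/
theorem Ys_mem_mackeySpan {N p M : ℕ} (hp : p ≤ M) (hM : M ≤ N) :
    (∀ k < p, Ys q N 0 M k ∈ mackeySpan q N p M k) ∧
      Ys q N 0 M p - algebraMap 𝕜 _ (q ^ (p * (M - p))) ∈ mackeySpan q N p M p := by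
  induction M, hp using Nat.le_induction with
  | base =>
    refine ⟨fun k hk => ?_, by simp [Ys_self]⟩
    exact Submodule.subset_span ⟨k, 1, one_mem _, hk, le_rfl, le_rfl, by simp [block]⟩
  | succ M hpM ih =>
    obtain ⟨ih1, ih2⟩ := ih (by omega)
    constructor
    · intro k hk
      obtain _ | k := k
      · rw [Ys_zero]
        exact Submodule.subset_span ⟨0, 1, one_mem _, hk, le_rfl, by omega, by simp [block, Ys_zero]⟩
      · rw [Ys_succ q N 0 M k (by omega) (by omega), zero_add]
        exact add_mem (Submodule.smul_mem _ _ (mackeySpan_succ q N p M _ (ih1 _ hk)))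
          (Submodule.smul_mem _ _ (mul_descT_mem_mackeySpan q (ih1 k (by omega))))
    · obtain _ | p := p
      · simp [Ys_zero]
      · rw [Ys_succ q N 0 M p (by omega) (by omega), zero_add, add_sub_right_comm]
        refine add_mem ?_
          (Submodule.smul_mem _ _ (mul_descT_mem_mackeySpan q (ih1 p (by omega))))
        -- Only the first summand of the recursion contributes to the scalar, multiplying it by
        -- q^{p+1}; the second has the smaller block size p and lies entirely in the span.
        have e : algebraMap 𝕜 (HeckeAlgebra q N) (q ^ ((p + 1) * (M + 1 - (p + 1)))) =
            q ^ (p + 1) • algebraMap 𝕜 _ (q ^ ((p + 1) * (M - (p + 1)))) := by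
          rw [Algebra.smul_def, ← map_mul, ← pow_add]
          congr 2
          rw [show M + 1 - (p + 1) = M - (p + 1) + 1 by omega]
          ring
        have h := Submodule.smul_mem _ (q ^ (p + 1)) (mackeySpan_succ q N _ M _ ih2)
        rw [e]
        simpa only [smul_sub] using h

/-- The cancellation argument, applied later to u = h ⊗ ω: the Mackey terms with i < k send u into
the image of y_k ⊗ Id, so the vanishing of the total leaves only a nonzero multiple of u itself. -/
theorem mem_range_As (hq : q ≠ 0) {k n : ℕ} (hk : k ≤ n) {M : Type*} [AddCommGroup M] [Module 𝕜 M]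
    (ρ : HeckeAlgebra q (k + n) →ₐ[𝕜] Module.End 𝕜 M) (u : M)
    (hu : ∀ i < k, u ∈ LinearMap.range (ρ (As q (k + n) 0 i * As q (k + n) k n)))
    (h : ρ (Ys q (k + n) 0 (k + n) k) u = 0) :
    u ∈ LinearMap.range (ρ (As q (k + n) 0 k)) := by
  have key : ∀ z ∈ mackeySpan q (k + n) k (k + n) k,
      ρ z u ∈ LinearMap.range (ρ (As q (k + n) 0 k)) := by
    intro z hz
    induction hz using Submodule.span_induction with
    | zero => simp
    | add a b _ _ ha hb => rw [map_add]; exact add_mem ha hb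
    | smul c a _ ha => rw [map_smul]; exact Submodule.smul_mem _ _ ha
    | mem z hz =>
      obtain ⟨i, x, hx, h1, -, -, rfl⟩ := hz
      obtain ⟨a, rfl⟩ : ∃ a, k = i + a := ⟨k - i, by omega⟩
      obtain ⟨w, rfl⟩ := hu i h1
      -- Possible because k ≤ n: the block of length a = k - i fits into the n positions occupied by
      -- y_n.
      obtain ⟨b, rfl⟩ : ∃ b, n = a + b := ⟨n - a, by omega⟩
      generalize hN : i + a + (a + b) = N at *
      obtain ⟨z, hz, hz'⟩ := exists_block_inv q hq (N := N) (le_refl (i + a)) a b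
      -- The block of length a is moved past all n = a + b positions, so that the whole of y_n can
      -- be carried across; the surplus braid is undone by z, which acts beyond the first k
      -- positions.
      have e1 : block q N i a a = z * block q N i a (a + b) := by
        rw [block_add, ← mul_assoc, hz', one_mul]
      obtain ⟨r, hr⟩ := As_add_right q N i a b (by omega)
      have e2 := block_mul_As q N i a (a + b) (by omega)
      have e3 := upper_comm_As q le_rfl (block_mem_upper q (N := N) (le_refl i) a (a + b))
      -- After y_n is carried to position i its left factor y_a is split off, and `As_add` assembles
      -- y_i and y_a into y_{i+a}, which commutes with x z.
      have e4 : Ys q N 0 (i + a) i * x * block q N i a a * (As q N 0 i * As q N (i + a) (a + b)) =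
          As q N 0 (i + a) * (x * z * r * block q N i a (a + b)) := by
        have hxz := mul_mem hx hz
        calc _ = Ys q N 0 (i + a) i * (x * z) *
              ((block q N i a (a + b) * As q N 0 i) * As q N (i + a) (a + b)) := by
              rw [e1]; simp only [mul_assoc]
          _ = x * z * Ys q N 0 (i + a) i *
              (As q N 0 i * (block q N i a (a + b) * As q N (i + a) (a + b))) := by
              rw [e3, upper_comm_Ys q le_rfl hxz]; simp only [mul_assoc]
          _ = x * z * (Ys q N 0 (i + a) i * (As q N 0 i * As q N i a)) *
                r * block q N i a (a + b) := by
              rw [e2, hr]; simp only [mul_assoc]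
          _ = _ := by
              rw [← As_add q N i a (by omega), upper_comm_As q le_rfl hxz]; simp only [mul_assoc]
      rw [← Module.End.mul_apply, ← map_mul, Nat.add_sub_cancel_left, e4, map_mul,
        Module.End.mul_apply]
      exact LinearMap.mem_range_self _ _
  -- The scalar part of the decomposition is isolated here; it is invertible since q ≠ 0.
  have h1 := key _ (Ys_mem_mackeySpan q (p := k) (M := k + n) (by omega) le_rfl).2
  rw [map_sub, LinearMap.sub_apply, h, AlgHom.commutes, Module.algebraMap_end_apply, zero_sub,
    neg_mem_iff] at h1
  have h2 := Submodule.smul_mem _ (q ^ (k * (k + n - k)))⁻¹ h1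
  rwa [smul_smul, inv_mul_cancel₀ (pow_ne_zero _ hq), one_smul] at h2

end HeckeAlgebra

variable {𝕜 V : Type*} [Field 𝕜] [AddCommGroup V] [Module 𝕜 V]

/-! ### Contractions of tensors -/

theorem tmul_induction {m n : ℕ} {C : ⨂[𝕜]^(m + n) V → Prop} (h0 : C 0)
    (ht : ∀ a b, C (tmul a b)) (ha : ∀ u v, C u → C v → C (u + v)) (u : ⨂[𝕜]^(m + n) V) : C u := by
  obtain ⟨t, rfl⟩ := (TensorPower.mulEquiv (R := 𝕜) (M := V) (n := m) (m := n)).surjective u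
  induction t with
  | zero => rwa [map_zero]
  | tmul a b => exact ht a b
  | add x y hx hy => rw [map_add]; exact ha _ _ hx hy

/-- The contraction of the last `n` factors of a tensor with a linear function. -/
def contract {m n : ℕ} (f : Module.Dual 𝕜 (⨂[𝕜]^n V)) : ⨂[𝕜]^(m + n) V →ₗ[𝕜] ⨂[𝕜]^m V :=
  (TensorProduct.rid 𝕜 _).toLinearMap ∘ₗ f.lTensor _ ∘ₗ
    (TensorPower.mulEquiv (R := 𝕜) (M := V) (n := m) (m := n)).symm.toLinearMap

theorem contract_tmul {m n : ℕ} (f : Module.Dual 𝕜 (⨂[𝕜]^n V)) (a : ⨂[𝕜]^m V) (b : ⨂[𝕜]^n V) :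
    contract f (tmul a b) = f b • a := by
  simp [contract, tmul]

/-- Expansion with respect to a basis of the last n factors; the coefficients are contractions with
coordinate functions. Thus properties of a tensor on its first m factors can be tested on
contractions. -/
theorem exists_eq_sum_tmul {m n : ℕ} (u : ⨂[𝕜]^(m + n) V) :
    ∃ (s : Finset (⨂[𝕜]^n V)) (f : ⨂[𝕜]^n V → Module.Dual 𝕜 (⨂[𝕜]^n V)),
      u = ∑ b ∈ s, tmul (contract (f b) u) b := by
  classical
  let B := Module.Basis.ofVectorSpace 𝕜 (⨂[𝕜]^n V)
  obtain ⟨c, hc⟩ := TensorProduct.eq_repr_basis_right B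
    ((TensorPower.mulEquiv (R := 𝕜) (M := V) (n := m) (m := n)).symm u)
  have hu : u = ∑ i ∈ c.support, tmul (c i) (B i) := by
    rw [LinearEquiv.eq_symm_apply, Finsupp.sum, map_sum] at hc
    exact hc.symm
  have hc' : ∀ i, contract (B.coord i) u = c i := by
    intro i
    rw [hu, map_sum]
    simp only [contract_tmul, Module.Basis.coord_apply, Module.Basis.repr_self,
      Finsupp.single_apply, ite_smul, one_smul, zero_smul]
    rw [Finset.sum_ite_eq']
    simp +contextual
  -- The sum is indexed by the basis vectors themselves, so the coordinate function is recovered by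
  -- choosing an index; injectivity of the basis makes the choice unique. The value 0 elsewhere is
  -- never used.
  refine ⟨c.support.image B, fun b => if h : ∃ i, B i = b then B.coord h.choose else 0, ?_⟩
  rw [Finset.sum_image fun i _ j _ h => B.injective h]
  conv_lhs => rw [hu]
  refine Finset.sum_congr rfl fun i _ => ?_
  have h : ∃ j, B j = B i := ⟨i, rfl⟩
  dsimp only
  rw [dif_pos h, B.injective h.choose_spec, hc']

/-! ### The spaces Υ^(m) and the images of the antisymmetrizers -/

namespace HeckeSymmetry

variable (H : HeckeSymmetry 𝕜 V)

theorem contract_rep {m n : ℕ} (f : Module.Dual 𝕜 (⨂[𝕜]^n V)) (x : HeckeAlgebra H.q m)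
    (u : ⨂[𝕜]^(m + n) V) :
    contract f (H.rep (m + n) (HeckeAlgebra.shift H.q 0 (by omega) x) u) =
      H.rep m x (contract f u) := by
  induction u using tmul_induction with
  | h0 => simp
  | ht a b => rw [rep_tmul_left, contract_tmul, contract_tmul, map_smul]
  | ha u v hu hv => simp only [map_add, hu, hv]

theorem mem_range_rep_of_contract {m n : ℕ} (x : HeckeAlgebra H.q m) (u : ⨂[𝕜]^(m + n) V)
    (h : ∀ f : Module.Dual 𝕜 (⨂[𝕜]^n V), contract f u ∈ LinearMap.range (H.rep m x)) :
    u ∈ LinearMap.range (H.rep (m + n) (HeckeAlgebra.shift H.q 0 (by omega) x)) := by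
  obtain ⟨s, f, hu⟩ := exists_eq_sum_tmul u
  rw [hu]
  refine sum_mem fun b _ => ?_
  obtain ⟨a, ha⟩ := h (f b)
  exact ⟨tmul a b, by rw [rep_tmul_left, ha]⟩

/-- Contraction of the last factors commutes with the generators acting on the first m positions, so
it preserves membership in the images of T_j - q. -/
theorem contract_mem_upsilon {m n : ℕ} {u : ⨂[𝕜]^(m + n) V} (hu : u ∈ H.upsilon (m + n))
    (f : Module.Dual 𝕜 (⨂[𝕜]^n V)) : contract f u ∈ H.upsilon m := by
  rw [mem_upsilon_iff] at hu ⊢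
  intro j hj
  obtain ⟨w, hw⟩ := hu j (by omega)
  refine ⟨contract f w, ?_⟩
  rw [← contract_rep, map_sub, AlgHom.commutes, HeckeAlgebra.shift_g _ _ _ _ hj, zero_add, hw]

/-- All contractions down to degree n + 1 vanish, and a tensor is determined by its contractions. -/
theorem upsilon_eq_bot {n : ℕ} (h : H.upsilon (n + 1) = ⊥) {m : ℕ} (hm : n < m) :
    H.upsilon m = ⊥ := by
  obtain ⟨l, rfl⟩ := Nat.exists_eq_add_of_lt hm
  rw [show n + l + 1 = n + 1 + l by omega, eq_bot_iff]
  intro u hu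
  obtain ⟨s, f, e⟩ := exists_eq_sum_tmul u
  rw [Submodule.mem_bot, e]
  refine Finset.sum_eq_zero fun b _ => ?_
  have := H.contract_mem_upsilon hu (f b)
  rw [h, Submodule.mem_bot] at this
  rw [this, zero_tmul]

theorem upsilon_eq_top {n : ℕ} (h : n ≤ 1) : H.upsilon n = ⊤ := by
  rw [eq_top_iff]
  intro u _
  rw [mem_upsilon_iff]
  intro j hj
  omega

/-- The identity y_{m+n}(a ⊗ b) = (y_m a) ⋆ (y_n b), the link between antisymmetrizers and the
product of Υ. -/
theorem rep_antisymmetrizer_add {m n : ℕ} (a : ⨂[𝕜]^m V) (b : ⨂[𝕜]^n V) :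
    H.rep (m + n) (HeckeAlgebra.antisymmetrizer H.q (m + n)) (tmul a b) =
      H.rep (m + n) (HeckeAlgebra.shuffleAntisymmetrizer H.q (m + n) m)
        (tmul (H.rep m (HeckeAlgebra.antisymmetrizer H.q m) a)
          (H.rep n (HeckeAlgebra.antisymmetrizer H.q n) b)) := by
  have e := HeckeAlgebra.As_add H.q (m + n) m n le_rfl
  rw [HeckeAlgebra.As_eq H.q (by omega), HeckeAlgebra.As_eq H.q (by omega),
    HeckeAlgebra.As_eq H.q (by omega), HeckeAlgebra.shift_self, HeckeAlgebra.Ys_eq] at e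
  rw [e, map_mul, map_mul, Module.End.mul_apply, Module.End.mul_apply, rep_tmul_right,
    rep_tmul_left]

theorem rep_antisymmetrizer_of_le_one {n : ℕ} (h : n ≤ 1) :
    H.rep n (HeckeAlgebra.antisymmetrizer H.q n) = 1 := by
  interval_cases n
  · rw [HeckeAlgebra.antisymmetrizer_zero, map_one]
  · rw [HeckeAlgebra.antisymmetrizer_one, map_one]

/-- By induction y_{n+1}(a ⊗ b) = (y_n a) ⋆ b is a product of elements of Υ. -/
theorem rep_antisymmetrizer_mem_upsilon {n : ℕ} (u : ⨂[𝕜]^n V) :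
    H.rep n (HeckeAlgebra.antisymmetrizer H.q n) u ∈ H.upsilon n := by
  induction n with
  | zero => rw [H.upsilon_eq_top zero_le_one]; trivial
  | succ n ih =>
    induction u using tmul_induction with
    | h0 => simp
    | ht a b =>
      rw [rep_antisymmetrizer_add]
      exact H.star_mem (ih a) (by rw [H.upsilon_eq_top le_rfl]; trivial)
    | ha u v hu hv => rw [map_add]; exact add_mem hu hv

/-- If `Υ^{(n)}` is one dimensional, `Υ^{(n+1)} = 0`, and the antisymmetrizer `y_n` acts as a
nonzero operator, then all `Υ^{(k)}` are images of antisymmetrizers. -/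
theorem upsilon_eq_range {n : ℕ} (h₁ : Module.finrank 𝕜 (H.upsilon n) = 1)
    (h₂ : H.upsilon (n + 1) = ⊥) (hy : H.rep n (HeckeAlgebra.antisymmetrizer H.q n) ≠ 0) (k : ℕ) :
    H.upsilon k = LinearMap.range (H.rep k (HeckeAlgebra.antisymmetrizer H.q k)) := by
  refine le_antisymm ?_ (by rintro _ ⟨u, rfl⟩; exact H.rep_antisymmetrizer_mem_upsilon u)
  rcases Nat.lt_or_ge n k with hk | hk
  · rw [H.upsilon_eq_bot h₂ hk]; exact bot_le
  -- A nonzero vector of Im y_n spans the one dimensional space Υ^(n).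
  have hn : H.upsilon n ≤ LinearMap.range (H.rep n (HeckeAlgebra.antisymmetrizer H.q n)) := by
    obtain ⟨w, hw⟩ : ∃ w, H.rep n (HeckeAlgebra.antisymmetrizer H.q n) w ≠ 0 := by
      by_contra! hc
      exact hy (LinearMap.ext hc)
    intro u hu
    obtain ⟨c, hc⟩ := (finrank_eq_one_iff_of_nonzero'
      (⟨_, H.rep_antisymmetrizer_mem_upsilon w⟩ : H.upsilon n) (by simpa using hw)).1 h₁ ⟨u, hu⟩
    exact ⟨c • w, by rw [map_smul]; exact congrArg Subtype.val hc⟩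
  obtain ⟨ω, hω, hω0⟩ := (Submodule.ne_bot_iff (H.upsilon n)).1 fun h => by
    rw [h, finrank_bot] at h₁
    exact zero_ne_one h₁
  obtain ⟨f, hf⟩ : ∃ f : Module.Dual 𝕜 (⨂[𝕜]^n V), f ω ≠ 0 := by
    by_contra! hc
    exact hω0 ((Module.forall_dual_apply_eq_zero_iff 𝕜 ω).1 hc)
  induction k using Nat.strong_induction_on with
  | _ k ih =>
  intro h hh
  obtain _ | k := k
  · rw [H.rep_antisymmetrizer_of_le_one zero_le_one]
    exact ⟨h, rfl⟩
  -- Here the degree k + 1 is positive, which is what makes h ⋆ ω vanish; in degree 0 the claim is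
  -- trivial as y_0 = 1.
  have hu := HeckeAlgebra.mem_range_As H.q H.q_ne_zero hk (H.rep (k + 1 + n)) (tmul h ω) ?_ ?_
  · obtain ⟨w, hw⟩ := hu
    -- Contracting h ⊗ ω with f gives f(ω) h.
    refine ⟨(f ω)⁻¹ • contract f w, ?_⟩
    rw [HeckeAlgebra.As_eq H.q (by omega)] at hw
    rw [map_smul, ← contract_rep, hw, contract_tmul, smul_smul, inv_mul_cancel₀ hf, one_smul]
  · intro i hi
    obtain ⟨w₂, rfl⟩ := hn hω
    have hki : ∃ l, k + 1 = i + l := ⟨k + 1 - i, by omega⟩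
    generalize k + 1 = p at *
    obtain ⟨l, rfl⟩ := hki
    -- The contractions of h to degree i lie in Υ^(i) = Im y_i by induction, so h ∈ Im(y_i ⊗ Id).
    obtain ⟨w₁, rfl⟩ := H.mem_range_rep_of_contract (HeckeAlgebra.antisymmetrizer H.q i) h
      fun f => ih i hi (by omega) (H.contract_mem_upsilon hh f)
    refine ⟨tmul w₁ w₂, ?_⟩
    rw [HeckeAlgebra.As_eq H.q (by omega), HeckeAlgebra.As_eq H.q (by omega), map_mul,
      Module.End.mul_apply, rep_tmul_right, ← rep_tmul_left, HeckeAlgebra.shift_shift]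
  · rw [HeckeAlgebra.Ys_eq]
    -- The product h ⋆ ω lies in Υ^(k+1+n), a component of degree above n.
    have := H.star_mem hh hω
    rwa [H.upsilon_eq_bot h₂ (by omega), Submodule.mem_bot] at this

/-! ### The algebra `Υ(V, R)` -/

/-- The embedding of `Υ^{(m)}` in `Υ(V, R)`. -/
abbrev incl (m : ℕ) : H.upsilon m →ₗ[𝕜] H.UpsilonAlgebra :=
  DirectSum.lof 𝕜 ℕ (fun m => H.upsilon m) m

/-- The subalgebra of `Υ(V, R)` generated by `Υ^{(1)}`. -/
abbrev degOneSubalgebra : Subalgebra 𝕜 H.UpsilonAlgebra :=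
  Algebra.adjoin 𝕜 (Set.range (H.incl 1))

theorem incl_mul_incl {i j : ℕ} (a : H.upsilon i) (b : H.upsilon j) :
    H.incl i a * H.incl j b = H.incl (i + j) (H.star a b) :=
  DirectSum.of_mul_of (A := fun m => H.upsilon m) a b

/-- Stated for a predicate in all degrees at once, which avoids transporting elements along i = j.
-/
theorem incl_apply (i j : ℕ) (a : H.upsilon i) (C : ∀ k, H.upsilon k → Prop) (hi : i = j → C i a)
    (h0 : i ≠ j → C j 0) : C j (H.incl i a j) := by
  rcases eq_or_ne i j with rfl | hij
  · rw [DirectSum.lof_apply]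
    exact hi rfl
  · rw [DirectSum.lof_eq_of, DirectSum.of_eq_of_ne _ _ _ hij.symm]
    exact h0 hij

theorem mul_mem_of_components {K : Submodule 𝕜 H.UpsilonAlgebra} (a b : H.UpsilonAlgebra)
    (h : ∀ i j, H.incl i (a i) * H.incl j (b j) ∈ K) : a * b ∈ K := by
  classical
  rw [← DirectSum.sum_support_of a, ← DirectSum.sum_support_of b, Finset.sum_mul_sum]
  exact sum_mem fun i _ => sum_mem fun j _ => h i j

theorem exists_eq_smul_one (a : H.upsilon 0) : ∃ c : 𝕜, a = c • H.one := by
  let e := PiTensorProduct.isEmptyEquiv (R := 𝕜) (s := fun _ => V) (Fin 0)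
  refine ⟨e a.1, Subtype.ext (e.injective ?_)⟩
  rw [Submodule.coe_smul, map_smul]
  simp [e, one]

theorem incl_smul_one (c : 𝕜) : H.incl 0 (c • H.one) = algebraMap 𝕜 H.UpsilonAlgebra c := rfl

/-- Splits off the degree 0 component, which is a scalar since V^{⊗0} is a line. -/
theorem exists_eq_add_algebraMap (a : H.UpsilonAlgebra) :
    ∃ (b : H.UpsilonAlgebra) (c : 𝕜), b 0 = 0 ∧ a = b + algebraMap 𝕜 H.UpsilonAlgebra c := by
  obtain ⟨c, hc⟩ := H.exists_eq_smul_one (a 0)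
  refine ⟨a - algebraMap 𝕜 H.UpsilonAlgebra c, c, ?_, (sub_add_cancel _ _).symm⟩
  rw [DirectSum.sub_apply, ← incl_smul_one, DirectSum.lof_apply, hc, sub_self]

theorem degOneSubalgebra_eq_top (h : ∀ m u, H.incl m u ∈ H.degOneSubalgebra) :
    H.degOneSubalgebra = ⊤ := by
  rw [eq_top_iff]
  intro a _
  induction a using DirectSum.induction_on with
  | zero => exact zero_mem _
  | of m u => exact h m u
  | add a b ha hb => exact add_mem (ha trivial) (hb trivial)

/-- Elements of Im y_{m+1} are sums of products (y_m a) ⋆ b with b of degree 1, so induction on the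
degree applies. -/
theorem incl_range_mem_degOneSubalgebra {m : ℕ} (w : ⨂[𝕜]^m V) (u : H.upsilon m)
    (hu : H.rep m (HeckeAlgebra.antisymmetrizer H.q m) w = u) :
    H.incl m u ∈ H.degOneSubalgebra := by
  induction m with
  | zero =>
    obtain ⟨c, rfl⟩ := H.exists_eq_smul_one u
    rw [incl_smul_one]
    exact Subalgebra.algebraMap_mem _ _
  | succ m ih =>
    induction w using tmul_induction generalizing u with
    | h0 =>
      obtain rfl : 0 = u := Subtype.ext (by rw [← hu, map_zero]; rfl)
      rw [map_zero]
      exact zero_mem _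
    | ht a b =>
      rw [rep_antisymmetrizer_add] at hu
      have e : H.star ⟨_, H.rep_antisymmetrizer_mem_upsilon a⟩
        ⟨_, H.rep_antisymmetrizer_mem_upsilon b⟩ = u := Subtype.ext hu
      rw [← e, ← incl_mul_incl]
      exact mul_mem (ih a _ rfl) (Algebra.subset_adjoin ⟨_, rfl⟩)
    | ha v w hv hw =>
      have e : (⟨_, H.rep_antisymmetrizer_mem_upsilon v⟩ : H.upsilon (m + 1)) +
        ⟨_, H.rep_antisymmetrizer_mem_upsilon w⟩ = u := Subtype.ext (by rw [← hu, map_add]; rfl)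
      rw [← e, map_add]
      exact add_mem (hv _ rfl) (hw _ rfl)

/-- The elements of `Υ(V, R)` whose components lie in the images of the antisymmetrizers. -/
def rangeSubmodule : Submodule 𝕜 H.UpsilonAlgebra :=
  ⨅ m, ((LinearMap.range (H.rep m (HeckeAlgebra.antisymmetrizer H.q m))).comap
    (H.upsilon m).subtype).comap (DirectSum.component 𝕜 ℕ (fun m => H.upsilon m) m)

theorem mem_rangeSubmodule {a : H.UpsilonAlgebra} : a ∈ H.rangeSubmodule ↔
    ∀ m, (a m : ⨂[𝕜]^m V) ∈ LinearMap.range (H.rep m (HeckeAlgebra.antisymmetrizer H.q m)) := by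
  rw [rangeSubmodule, Submodule.mem_iInf]
  rfl

theorem incl_mem_rangeSubmodule {m : ℕ} (u : H.upsilon m)
    (h : (u : ⨂[𝕜]^m V) ∈ LinearMap.range (H.rep m (HeckeAlgebra.antisymmetrizer H.q m))) :
    H.incl m u ∈ H.rangeSubmodule := by
  rw [mem_rangeSubmodule]
  intro j
  exact H.incl_apply m j u (fun k v => (v : ⨂[𝕜]^k V) ∈
    LinearMap.range (H.rep k (HeckeAlgebra.antisymmetrizer H.q k))) (fun _ => h)
    fun _ => zero_mem _

theorem incl_mem_rangeSubmodule_of_le_one {m : ℕ} (hm : m ≤ 1) (u : H.upsilon m) :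
    H.incl m u ∈ H.rangeSubmodule :=
  H.incl_mem_rangeSubmodule u
    ⟨u, by rw [H.rep_antisymmetrizer_of_le_one hm, Module.End.one_apply]⟩

/-- The sum of the images Im y_m contains the scalars and V, and is closed under ⋆ by
`rep_antisymmetrizer_add`. -/
theorem degOneSubalgebra_le_rangeSubmodule {a : H.UpsilonAlgebra} (ha : a ∈ H.degOneSubalgebra) :
    a ∈ H.rangeSubmodule := by
  induction ha using Algebra.adjoin_induction with
  | mem a ha =>
    obtain ⟨u, rfl⟩ := ha
    exact H.incl_mem_rangeSubmodule_of_le_one le_rfl u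
  | algebraMap c =>
    rw [← incl_smul_one]
    exact H.incl_mem_rangeSubmodule_of_le_one zero_le_one _
  | add a b _ _ ha hb => exact add_mem ha hb
  | mul a b _ _ ha hb =>
    rw [mem_rangeSubmodule] at ha hb
    refine H.mul_mem_of_components a b fun i j => ?_
    rw [incl_mul_incl]
    obtain ⟨v, hv⟩ := ha i
    obtain ⟨w, hw⟩ := hb j
    refine H.incl_mem_rangeSubmodule _ ⟨tmul v w, ?_⟩
    rw [rep_antisymmetrizer_add, hv, hw]
    rfl

/-! ### The homomorphism from `Λ(V, R)` to `Υ(V, R)` -/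

/-- The identification of `V` with `Υ^{(1)}`. -/
def degOne : V ≃ₗ[𝕜] H.upsilon 1 :=
  (PiTensorProduct.subsingletonEquiv (R := 𝕜) (s := fun _ : Fin 1 => V) 0).symm ≪≫ₗ
    (LinearEquiv.ofTop _ (H.upsilon_eq_top le_rfl)).symm

theorem coe_degOne (v : V) : (H.degOne v : ⨂[𝕜]^1 V) = PiTensorProduct.tprod 𝕜 fun _ => v := by
  apply (PiTensorProduct.subsingletonEquiv (R := 𝕜) (s := fun _ : Fin 1 => V) 0).injective
  simp [degOne]

/-- Comes from y_{2/1,1} = q - T_1. The map `ins 0 0` is the identification of V ⊗ V with V^{⊗2}. -/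
theorem star_degOne (x y : V) :
    (H.star (H.degOne x) (H.degOne y) : ⨂[𝕜]^(1 + 1) V) =
      -ins (n := 2) 0 0 ((H.R - H.q • LinearMap.id : V ⊗[𝕜] V →ₗ[𝕜] V ⊗[𝕜] V) (x ⊗ₜ y)) := by
  have e := HeckeAlgebra.shuffleAntisymmetrizer_succ H.q 1 0 one_pos
  have e2 : HeckeAlgebra.shuffleAntisymmetrizer H.q 1 (0 + 1) = 1 :=
    HeckeAlgebra.shuffleAntisymmetrizer_self H.q 1
  have e3 : HeckeAlgebra.descT H.q (1 + 1) 0 (1 - 0) = HeckeAlgebra.gen H.q (n := 2) 0 := by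
    simp [HeckeAlgebra.descT, HeckeAlgebra.g]
  rw [HeckeAlgebra.shuffleAntisymmetrizer_zero, e2, e3, map_one, one_mul] at e
  -- With two positions both entries of the base vector are overwritten, so its choice is
  -- irrelevant.
  have e4 : ∀ v : Fin 2 → V, ins (𝕜 := 𝕜) (n := 2) 0 v = ins 0 0 := fun v =>
    ins_congr _ _ _ fun l h0 h1 => by
      have := l.2
      simp at h0 h1
      omega
  have e5 : tmul (H.degOne x : ⨂[𝕜]^1 V) (H.degOne y : ⨂[𝕜]^1 V) =
      PiTensorProduct.tprod 𝕜 (![x, y] : Fin 2 → V) := by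
    rw [coe_degOne, coe_degOne, tmul_tprod]
    congr 1
    funext i
    fin_cases i <;> rfl
  rw [star]
  simp only
  rw [e5]
  change H.rep 2 (HeckeAlgebra.shuffleAntisymmetrizer H.q (1 + 1) (0 + 1)) _ = _
  rw [e, map_add, map_smul, map_smul, map_one, rep_gen]
  rw [LinearMap.add_apply, LinearMap.smul_apply, LinearMap.smul_apply, act_tprod, e4,
    LinearMap.sub_apply, map_sub, neg_sub, LinearMap.smul_apply, LinearMap.id_apply, map_smul,
    Module.End.one_apply]
  have e6 := ins_self (𝕜 := 𝕜) (n := 2) 0 ![x, y]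
  rw [e4] at e6
  rw [← e6]
  simp [sub_eq_add_neg]

/-- The homomorphism from the tensor algebra to `Υ(V, R)` that extends the identification of `V`
with `Υ^{(1)}`. -/
def tensorToUpsilon : TensorAlgebra 𝕜 V →ₐ[𝕜] H.UpsilonAlgebra :=
  TensorAlgebra.lift 𝕜 (H.incl 1 ∘ₗ H.degOne.toLinearMap)

theorem tensorToUpsilon_ι (v : V) :
    H.tensorToUpsilon (TensorAlgebra.ι 𝕜 v) = H.incl 1 (H.degOne v) := by
  simp [tensorToUpsilon]

/-- Shows that exactly the operator R - q decides the image of a quadratic tensor, so that the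
relations of Λ hold in Υ. -/
theorem tensorToUpsilon_tensorTwo (t : V ⊗[𝕜] V) : ∃ s : H.upsilon (1 + 1),
    H.tensorToUpsilon (tensorTwo 𝕜 V t) = H.incl (1 + 1) s ∧
      (s : ⨂[𝕜]^(1 + 1) V) =
        -ins (n := 2) 0 0 ((H.R - H.q • LinearMap.id : V ⊗[𝕜] V →ₗ[𝕜] V ⊗[𝕜] V) t) := by
  induction t with
  | zero => exact ⟨0, by simp, by simp⟩
  | tmul x y =>
    refine ⟨H.star (H.degOne x) (H.degOne y), ?_, H.star_degOne x y⟩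
    have : tensorTwo 𝕜 V (x ⊗ₜ y) = TensorAlgebra.ι 𝕜 x * TensorAlgebra.ι 𝕜 y := rfl
    rw [this, map_mul, tensorToUpsilon_ι, tensorToUpsilon_ι, incl_mul_incl]
  | add t u ht hu =>
    obtain ⟨a, ha, ha'⟩ := ht
    obtain ⟨b, hb, hb'⟩ := hu
    refine ⟨a + b, by rw [map_add, map_add, map_add, ha, hb], ?_⟩
    rw [Submodule.coe_add, ha', hb', map_add, map_add, neg_add]

/-- The homomorphism from `Λ(V, R)` to `Υ(V, R)`. -/
def lambdaToUpsilon : H.LambdaAlgebra →ₐ[𝕜] H.UpsilonAlgebra :=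
  RingQuot.liftAlgHom 𝕜 ⟨H.tensorToUpsilon, by
    rintro x y ⟨⟨t, ht, rfl⟩, rfl⟩
    obtain ⟨s, hs, hs'⟩ := H.tensorToUpsilon_tensorTwo t
    rw [LinearMap.mem_ker.1 ht, map_zero, neg_zero] at hs'
    obtain rfl : s = 0 := Subtype.ext hs'
    rw [hs, map_zero, map_zero]⟩

theorem lambdaToUpsilon_mk (x : TensorAlgebra 𝕜 V) :
    H.lambdaToUpsilon (RingQuot.mkAlgHom 𝕜 H.lambdaRel x) = H.tensorToUpsilon x := by
  simp [lambdaToUpsilon]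

theorem tensorToUpsilon_mem_range (m : ℕ) (x : TensorAlgebra 𝕜 V)
    (hx : x ∈ LinearMap.range (TensorAlgebra.ι 𝕜 (M := V)) ^ m) :
    ∃ u, H.tensorToUpsilon x = H.incl m u := by
  suffices h : LinearMap.range (TensorAlgebra.ι 𝕜 (M := V)) ^ m ≤
      (LinearMap.range (H.incl m)).comap H.tensorToUpsilon.toLinearMap by
    obtain ⟨u, hu⟩ := h hx
    exact ⟨u, hu.symm⟩
  clear hx x
  induction m with
  | zero =>
    rw [pow_zero, Submodule.one_le]
    exact ⟨H.one, (map_one H.tensorToUpsilon).symm⟩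
  | succ m ih =>
    rw [pow_succ, Submodule.mul_le]
    rintro x hx _ ⟨v, rfl⟩
    obtain ⟨u, hu⟩ := ih hx
    refine ⟨H.star u (H.degOne v), ?_⟩
    rw [← incl_mul_incl, hu, ← tensorToUpsilon_ι]
    exact (map_mul H.tensorToUpsilon _ _).symm

theorem lambdaToUpsilon_surjective (h : H.degOneSubalgebra = ⊤) :
    Function.Surjective H.lambdaToUpsilon := by
  rw [← AlgHom.range_eq_top, eq_top_iff, ← h, Algebra.adjoin_le_iff]
  rintro _ ⟨u, rfl⟩
  refine ⟨RingQuot.mkAlgHom 𝕜 H.lambdaRel (TensorAlgebra.ι 𝕜 (H.degOne.symm u)), ?_⟩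
  exact (H.lambdaToUpsilon_mk _).trans (by rw [tensorToUpsilon_ι, LinearEquiv.apply_symm_apply])

/-- The first isomorphism theorem for the canonical map from Λ to Υ, which is surjective when V
generates Υ and respects degrees by construction. -/
theorem exists_graded_equiv (h : H.degOneSubalgebra = ⊤) :
    ∃ (J : TwoSidedIdeal H.LambdaAlgebra) (e : J.ringCon.Quotient ≃ₐ[𝕜] H.UpsilonAlgebra),
      ∀ m : ℕ, ∀ x ∈ H.lambda m, ∃ u : H.upsilon m, e (J.ringCon.mk' x) = H.incl m u := by
  refine ⟨TwoSidedIdeal.ker H.lambdaToUpsilon, AlgEquiv.ofBijective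
    (RingCon.liftₐ _ H.lambdaToUpsilon le_rfl) ⟨?_, ?_⟩, ?_⟩
  · exact RingCon.kerLiftₐ_injective H.lambdaToUpsilon
  · intro a
    obtain ⟨x, rfl⟩ := H.lambdaToUpsilon_surjective h a
    exact ⟨RingCon.mk' _ x, rfl⟩
  · rintro m _ ⟨x, hx, rfl⟩
    obtain ⟨u, hu⟩ := H.tensorToUpsilon_mem_range m x hx
    exact ⟨u, (H.lambdaToUpsilon_mk x).trans hu⟩

/-! ### Algebras isomorphic to `Υ(V, R)` and generated by `V` -/

/-- The subspace of `Υ^{(m)}` cut out by the subalgebra generated by `Υ^{(1)}`. -/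
def decomposables (m : ℕ) : Submodule 𝕜 (H.upsilon m) :=
  (Subalgebra.toSubmodule H.degOneSubalgebra).comap (H.incl m)

/-- The component of degree `1` of an element of `Υ(V, R)` together with the class of its component
of degree `m` modulo decomposable elements. -/
def indecomposablePart (m : ℕ) :
    H.UpsilonAlgebra →ₗ[𝕜] H.upsilon 1 × (H.upsilon m ⧸ H.decomposables m) :=
  (DirectSum.component 𝕜 ℕ (fun m => H.upsilon m) 1).prod
    ((H.decomposables m).mkQ ∘ₗ DirectSum.component 𝕜 ℕ (fun m => H.upsilon m) m)

theorem indecomposablePart_apply (m : ℕ) (a : H.UpsilonAlgebra) :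
    H.indecomposablePart m a = (a 1, (H.decomposables m).mkQ (a m)) := rfl

theorem indecomposablePart_incl {m i : ℕ} (u : H.upsilon i) (hi : i ≠ 1)
    (h : i = m → H.incl i u ∈ H.degOneSubalgebra) : H.indecomposablePart m (H.incl i u) = 0 := by
  rw [indecomposablePart_apply, Prod.mk_eq_zero]
  refine ⟨DirectSum.of_eq_of_ne _ _ _ hi.symm, (Submodule.Quotient.mk_eq_zero _).2 ?_⟩
  exact H.incl_apply i m u (fun k v => v ∈ H.decomposables k) h fun _ => zero_mem _

/-- A product of homogeneous elements of positive degrees has degree at least 2; if this degree is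
m, both factors have degree below m and lie in the generated subalgebra, so the product is
decomposable. -/
theorem indecomposablePart_mul_eq_zero {m : ℕ}
    (ih : ∀ i < m, ∀ u, H.incl i u ∈ H.degOneSubalgebra) {a b : H.UpsilonAlgebra} (ha : a 0 = 0)
    (hb : b 0 = 0) : H.indecomposablePart m (a * b) = 0 := by
  refine H.mul_mem_of_components (K := LinearMap.ker (H.indecomposablePart m)) a b fun i j => ?_
  obtain _ | i := i
  · rw [ha, map_zero, zero_mul]; exact zero_mem _
  obtain _ | j := j
  · rw [hb, map_zero, mul_zero]; exact zero_mem _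
  rw [incl_mul_incl, LinearMap.mem_ker]
  refine H.indecomposablePart_incl _ (by omega) fun h => ?_
  rw [← incl_mul_incl]
  exact mul_mem (ih _ (by omega) _) (ih _ (by omega) _)

theorem indecomposablePart_algebraMap {m : ℕ} (c : 𝕜) :
    H.indecomposablePart m (algebraMap 𝕜 H.UpsilonAlgebra c) = 0 := by
  rw [← incl_smul_one]
  exact H.indecomposablePart_incl _ zero_ne_one fun _ => Subalgebra.algebraMap_mem _ c

/-- The map is a derivation along the augmentation: c and d are the degree 0 components of b and a.
Hence on products of generators it takes values in the span of the values on the generators. -/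
theorem exists_indecomposablePart_mul {m : ℕ}
    (ih : ∀ i < m, ∀ u, H.incl i u ∈ H.degOneSubalgebra) (a b : H.UpsilonAlgebra) :
    ∃ c d : 𝕜, H.indecomposablePart m (a * b) =
      c • H.indecomposablePart m a + d • H.indecomposablePart m b := by
  obtain ⟨a, d, ha, rfl⟩ := H.exists_eq_add_algebraMap a
  obtain ⟨b, c, hb, rfl⟩ := H.exists_eq_add_algebraMap b
  refine ⟨c, d, ?_⟩
  rw [add_mul, mul_add, mul_add, ← Algebra.commutes c a, ← Algebra.smul_def, ← Algebra.smul_def,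
    ← map_mul]
  simp only [map_add, map_smul, indecomposablePart_algebraMap,
    H.indecomposablePart_mul_eq_zero ih ha hb, add_zero, zero_add]

/-- No compatibility of φ with the gradings is assumed. By induction on m, the indecomposable part
of φ(x) always lies in the image of V, so dim Υ^(1) + dim(Υ^(m)/decomposables) ≤ dim V; as Υ^(1) ≅
V, the quotient vanishes. -/
theorem degOneSubalgebra_eq_top_of_surjective [FiniteDimensional 𝕜 V]
    (φ : TensorAlgebra 𝕜 V →ₐ[𝕜] H.UpsilonAlgebra) (hφ : Function.Surjective φ) :
    H.degOneSubalgebra = ⊤ := by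
  refine H.degOneSubalgebra_eq_top fun m => ?_
  induction m using Nat.strong_induction_on with
  | _ m ih =>
  intro u
  obtain rfl | rfl | hm : m = 0 ∨ m = 1 ∨ 2 ≤ m := by omega
  · obtain ⟨c, rfl⟩ := H.exists_eq_smul_one u
    exact Subalgebra.algebraMap_mem _ c
  · exact Algebra.subset_adjoin ⟨u, rfl⟩
  let π := H.indecomposablePart m
  have hπ : Function.Surjective π := by
    rintro ⟨x, y⟩
    obtain ⟨y, rfl⟩ := (H.decomposables m).mkQ_surjective y
    refine ⟨H.incl 1 x + H.incl m y, ?_⟩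
    -- Since m ≥ 2, the two components are independent of each other.
    have e1 : (H.incl m y) 1 = 0 := DirectSum.of_eq_of_ne _ _ _ (by omega)
    have e2 : (H.incl 1 x) m = 0 := DirectSum.of_eq_of_ne _ _ _ (by omega)
    rw [H.indecomposablePart_apply, DirectSum.add_apply, DirectSum.add_apply, e1, e2,
      DirectSum.lof_apply, DirectSum.lof_apply, add_zero, zero_add]
  let f : V →ₗ[𝕜] H.upsilon 1 × (H.upsilon m ⧸ H.decomposables m) :=
    π ∘ₗ φ.toLinearMap ∘ₗ TensorAlgebra.ι 𝕜
  have hf : Function.Surjective f := by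
    -- Scalars contribute nothing, and products contribute linear combinations of what their factors
    -- contribute, so V alone fills the image.
    have key : ∀ x, π (φ x) ∈ LinearMap.range f := by
      intro x
      induction x using TensorAlgebra.induction with
      | algebraMap c =>
        rw [AlgHom.commutes, H.indecomposablePart_algebraMap]
        exact zero_mem _
      | ι v => exact ⟨v, rfl⟩
      | mul x y hx hy =>
        obtain ⟨c, d, h⟩ := H.exists_indecomposablePart_mul ih (φ x) (φ y)
        rw [map_mul, h]
        exact add_mem (Submodule.smul_mem _ _ hx) (Submodule.smul_mem _ _ hy)
      | add x y hx hy =>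
        rw [map_add, map_add]
        exact add_mem hx hy
    intro z
    obtain ⟨a, rfl⟩ := hπ z
    obtain ⟨x, rfl⟩ := hφ a
    exact key x
  have : Module.Finite 𝕜 (H.upsilon 1) := Module.Finite.equiv H.degOne
  have : Module.Finite 𝕜 (H.upsilon 1 × (H.upsilon m ⧸ H.decomposables m)) :=
    Module.Finite.of_surjective f hf
  have : Module.Finite 𝕜 (H.upsilon m ⧸ H.decomposables m) :=
    Module.Finite.of_surjective (LinearMap.snd 𝕜 (H.upsilon 1) _) Prod.snd_surjective
  have h := LinearMap.finrank_le_finrank_of_surjective hf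
  rw [Module.finrank_prod, H.degOne.finrank_eq] at h
  have h0 : Module.finrank 𝕜 (H.upsilon m ⧸ H.decomposables m) = 0 := by omega
  have := Module.finrank_zero_iff.1 h0
  exact (Submodule.Quotient.mk_eq_zero _).1 (Subsingleton.elim ((H.decomposables m).mkQ u) 0)

end HeckeSymmetry

end

end HeckeSym

/-! ### The equivalence of the conditions -/

theorem proposition2p6 {𝕜 V : Type*} [Field 𝕜] [AddCommGroup V] [Module 𝕜 V]
    [FiniteDimensional 𝕜 V] (H : HeckeSym.HeckeSymmetry 𝕜 V) (n : ℕ)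
    (h₁ : Module.finrank 𝕜 (H.upsilon n) = 1) (h₂ : H.upsilon (n + 1) = ⊥) :
    List.TFAE [
      -- the action of the antisymmetrizer on the `n`th tensor power is nonzero
      H.rep n (HeckeSym.HeckeAlgebra.antisymmetrizer H.q n) ≠ 0,
      -- `Υ(V, R)` is generated by its component of degree `1`
      Algebra.adjoin 𝕜 (Set.range (DirectSum.lof 𝕜 ℕ (fun m => H.upsilon m) 1)) =
        (⊤ : Subalgebra 𝕜 H.UpsilonAlgebra),
      -- `Υ(V, R)` is isomorphic to a factor algebra of `Λ(V, R)`
      ∃ J : TwoSidedIdeal H.LambdaAlgebra,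
        Nonempty (J.ringCon.Quotient ≃ₐ[𝕜] H.UpsilonAlgebra),
      -- `Υ(V, R)` is isomorphic to a factor algebra of `Λ(V, R)` as a graded algebra
      ∃ (J : TwoSidedIdeal H.LambdaAlgebra) (e : J.ringCon.Quotient ≃ₐ[𝕜] H.UpsilonAlgebra),
        ∀ m : ℕ, ∀ x ∈ H.lambda m, ∃ u : H.upsilon m,
          e (J.ringCon.mk' x) = DirectSum.lof 𝕜 ℕ (fun m => H.upsilon m) m u] := by
  tfae_have 1 → 2 := fun hy => H.degOneSubalgebra_eq_top fun m u => by
    obtain ⟨w, hw⟩ := (H.upsilon_eq_range h₁ h₂ hy m).le u.2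
    exact H.incl_range_mem_degOneSubalgebra w u hw
  tfae_have 2 → 1 := by
    intro h hy
    have e : H.upsilon n = ⊥ := by
      rw [eq_bot_iff]
      intro u hu
      have h1 : H.incl n ⟨u, hu⟩ ∈ H.degOneSubalgebra := by
        rw [show H.degOneSubalgebra = ⊤ from h]; exact Algebra.mem_top
      -- If V generates Υ, every element of Υ^(n) lies in Im y_n, which is zero under the assumption
      -- made.
      have h2 := H.mem_rangeSubmodule.1 (H.degOneSubalgebra_le_rangeSubmodule h1) n
      rwa [DirectSum.lof_apply, hy, LinearMap.range_zero] at h2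
    rw [e, finrank_bot] at h₁
    exact zero_ne_one h₁
  tfae_have 2 → 4 := H.exists_graded_equiv
  tfae_have 4 → 3 := fun ⟨J, e, _⟩ => ⟨J, ⟨e⟩⟩
  tfae_have 3 → 2 := by
    rintro ⟨J, ⟨e⟩⟩
    -- The surjection is the composite of the tensor algebra onto Λ, onto the factor algebra, and
    -- the given isomorphism with Υ.
    refine H.degOneSubalgebra_eq_top_of_surjective
      ((e.toAlgHom.comp (J.ringCon.mkₐ 𝕜)).comp (RingQuot.mkAlgHom 𝕜 H.lambdaRel)) ?_
    exact (e.surjective.comp J.ringCon.mk'_surjective).comp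
      (RingQuot.mkAlgHom_surjective 𝕜 H.lambdaRel)
  tfae_finish
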